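/- Work with languages over the alphabet $\{0,1\}$. A language is *quadratic-time computable* if it belongs to $\mathrm{DTIME}(n^2)$, that is, if it is decided by a deterministic multitape Turing machine that halts on every input of length $n$ within $c(n^2+1)$ steps, for some constant $c\in\mathbb N$. Fix a standard effective numbering of all pairs $(M,c)$, where $M$ is a multitape Turing machine and $c\in\mathbb N$. If $e$ is the number of $(M,c)$, let $L_e$ be the language accepted by $M$ equipped with a clock that stops it, without acceptance, if it has not halted within $c(n^2+1)$ steps on the given input of length $n$. For sets $X,Y$ write $X\subseteq^* Y$ if $X\setminus Y$ is finite. **Theorem 3.8.** The sequence $(L_e)_{e\in\mathbb N}$ lists exactly the quadratic-time computable languages, and almost inclusion $$\{\langle e,i\rangle : L_e\subseteq^* L_i\}$$ is a $\Sigma^0_2$-complete preorder on $\mathbb N$. That is, it is a preorder (a reflexive and transitive relation), it is $\Sigma^0_2$, and for every $\Sigma^0_2$ preorder $S$ on $\mathbb N$ there is a computable function $g:\mathbb N\to\mathbb N$ such that for all $x,y\in\mathbb N$: $\;x\,S\,y$ if and only if $L_{g(x)}\subseteq^* L_{g(y)}$. -/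

import Mathlib

/-! ### Multitape Turing machines -/

/-- An instruction `((q, r), (q', u))` of a multitape Turing machine: in state `q`, when the list of
the symbols under the heads is `r`, go to state `q'` and, on the `i`-th tape, write `a` and move
the head according to `d`, where `(a, d)` is the `i`-th entry of `u`. -/
abbrev TMInstr : Type := (ℕ × List ℕ) × (ℕ × List (ℕ × ℕ))

/-- A deterministic multitape Turing machine `(k, P)`: it has `k + 1` two-way infinite tapes, and
its transition function is the finite table `P` of instructions (if several instructions of `P`
apply, the first one is meant; if none applies, the machine halts). States and tape symbols are
the (finitely many) natural numbers that matter for the table. The symbol `0` is the blank,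
`0` is the initial state, and a run is accepting if it halts in state `1`. -/
abbrev MultitapeTM : Type := ℕ × List TMInstr

namespace MultitapeTM

/-- A configuration: the state, and the tapes with their head positions. -/
structure Config (M : MultitapeTM) where
  state : ℕ
  tapes : Fin (M.1 + 1) → Turing.Tape ℕ

/-- Head movement: `0` is stay, `1` is left, everything else is right. -/
def moveHead (d : ℕ) (T : Turing.Tape ℕ) : Turing.Tape ℕ :=
  match d with
  | 0 => T
  | 1 => T.move Turing.Dir.left
  | _ => T.move Turing.Dir.right

/-- Write and move on one tape. A tape without a prescribed action is left as it is. -/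
def actOn (u : Option (ℕ × ℕ)) (T : Turing.Tape ℕ) : Turing.Tape ℕ :=
  match u with
  | none => T
  | some (a, d) => moveHead d (T.write a)

/-- The instruction that applies in a configuration, if there is one. -/
def instr? (M : MultitapeTM) (c : Config M) : Option TMInstr :=
  M.2.find? fun I => decide (I.1 = (c.state, List.ofFn fun i => (c.tapes i).head))

/-- One step of the machine; `none` means that the machine has halted. -/
def step (M : MultitapeTM) (c : Config M) : Option (Config M) :=
  (M.instr? c).map fun I =>
    { state := I.2.1
      tapes := fun i => actOn (I.2.2[(i : ℕ)]?) (c.tapes i) }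

/-- The initial configuration: the input word stands on tape `0`, with the head on its first letter
(the letters `0` and `1` of the input alphabet, `false` and `true`, are the tape symbols `1`
and `2`); all other tapes are blank. -/
def init (M : MultitapeTM) (w : List Bool) : Config M where
  state := 0
  tapes := fun i => Turing.Tape.mk₁ (if (i : ℕ) = 0 then w.map fun b => cond b 2 1 else [])

/-- The configuration after `t` steps; a configuration in which the machine has halted is kept. -/
def configAt (M : MultitapeTM) (w : List Bool) (t : ℕ) : Config M :=
  (fun c => (M.step c).getD c)^[t] (M.init w)

/-- On input `w`, the machine halts after at most `t` steps. -/
def HaltsWithin (M : MultitapeTM) (w : List Bool) (t : ℕ) : Prop :=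
  M.step (M.configAt w t) = none

/-- On input `w`, the machine halts after at most `t` steps and accepts. -/
def AcceptsWithin (M : MultitapeTM) (w : List Bool) (t : ℕ) : Prop :=
  M.HaltsWithin w t ∧ (M.configAt w t).state = 1

end MultitapeTM

/-! ### Time classes and clocked machines -/

/-- `DTIME(h)`: the languages over `{0, 1}` that are decided by a multitape Turing machine which,
for some constant `c`, halts on every input of length `n` within `c * (h n + 1)` steps. -/
def DTIME (h : ℕ → ℕ) : Set (Set (List Bool)) :=
  {L | ∃ (M : MultitapeTM) (c : ℕ), ∀ w : List Bool,
    M.HaltsWithin w (c * (h w.length + 1)) ∧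
      (w ∈ L ↔ M.AcceptsWithin w (c * (h w.length + 1)))}

/-- The language of the machine `M` equipped with a clock that stops it, without acceptance, if
it has not halted within `c * (h n + 1)` steps, where `n` is the length of the input. -/
def clockedLanguage (h : ℕ → ℕ) (M : MultitapeTM) (c : ℕ) : Set (List Bool) :=
  {w | M.AcceptsWithin w (c * (h w.length + 1))}

/-- The standard effective listing of `DTIME(n ^ 2)`: the number `e` is the code of a pair `(M, c)`
of a multitape Turing machine and a clock constant, and the `e`-th language is that of `M`, clocked
at `c * (n ^ 2 + 1)` steps. -/
def quadLang (e : ℕ) : Set (List Bool) :=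
  clockedLanguage (fun n => n ^ 2)
    (Denumerable.ofNat (MultitapeTM × ℕ) e).1 (Denumerable.ofNat (MultitapeTM × ℕ) e).2

/-- Almost inclusion: all but finitely many elements of `X` are in `Y`. -/
def AlmostSubset {α : Type*} (X Y : Set α) : Prop := (X \ Y).Finite

/-! ### Completeness of preorders under computable reducibility -/

/-- A binary relation on `ℕ` is `Σ⁰₂` if it is of the form `∃ a, ∀ b, Q x y a b` with `Q`
decidable. -/
def IsSigma02 (R : ℕ → ℕ → Prop) : Prop :=
  ∃ Q : ℕ × ℕ × ℕ × ℕ → Bool, Computable Q ∧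
    ∀ x y, R x y ↔ ∃ a, ∀ b, Q (x, y, a, b) = true

/-- `R ≤_c S`: there is a computable `g` with `R x y ↔ S (g x) (g y)` for all `x` and `y`. -/
def CompReducible (R S : ℕ → ℕ → Prop) : Prop :=
  ∃ g : ℕ → ℕ, Computable g ∧ ∀ x y, R x y ↔ S (g x) (g y)

/-- `R` is a `Σ⁰₂`-complete preorder: a `Σ⁰₂` preorder to which every `Σ⁰₂` preorder is
computably reducible. -/
def IsSigma02CompletePreorder (R : ℕ → ℕ → Prop) : Prop :=
  IsPreorder ℕ R ∧ IsSigma02 R ∧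
    ∀ S : ℕ → ℕ → Prop, IsPreorder ℕ S → IsSigma02 S → CompReducible S R

/-! ### Finite instruction tables -/

/-! A clocked language is in `DTIME` of the square because the clock can be built into a machine:
one sweep over a unary copy of the input per input letter writes n ^ 2 clock cells, one more is
added, each worth `c` units, and every simulated step uses up one unit (`ClockedTM.machine_spec`).
Conversely, a decider with its constant is one of the listed pairs. Membership of `w` in `quadLang
e` is primitive recursive in both arguments. Almost inclusion says that some length bounds all words
of the difference, which is `Σ⁰₂`.

For hardness, write `S x y` as `∃ a, ∀ b, Q x y a b` with `Q` primitive recursive. Consider pairs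
(D, n), where D is a subset of {0, ..., l - 1} and n is a stage, such that whenever u is in D and
some a < l is not refuted for (u, v) by the first n instances, v < l is in D too. In addition n must
be 0 or come right after the refutation of a triple below l, so that each l has only finitely many
pairs. Let A x be the set of pairs with x in D. If a witnesses `S x y`, then every pair in A x with
l > max y a is in A y, so only finitely many pairs are lost. If `S x y` fails, take for each large l
the cone {v < l | S x v} and a stage at which all false triples below l are refuted: by transitivity
this is a legal pair, and it contains x but not y (`PreorderApprox.finite_iff`).

The sets A x become languages by padding. A fixed one-tape machine computes D from the code i of the
pair; i is represented by the single word 1 ^ i 0 ^ (t + 1), where t is the exact running time on i.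
A two-tape machine runs the computation while reading the zeros, so it needs only linear time, and
then inspects the x-th bit of D. Since x affects only this inspection and the clock constant, the
index is computable in x (`exists_quadLang_eq_image`). Coding by distinct words preserves almost
inclusion. -/

theorem List.find?_key_eq_some {α β : Type*} [DecidableEq α] {l : List (α × β)} {a : α} {b : β}
    (h : (a, b) ∈ l) (hu : ∀ I ∈ l, I.1 = a → I.2 = b) :
    l.find? (fun I => decide (I.1 = a)) = some (a, b) := by
  cases hf : l.find? (fun I => decide (I.1 = a)) with
  | none => exact absurd (List.find?_eq_none.1 hf _ h) (by simp)
  | some I =>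
    have h1 : I.1 = a := by simpa using List.find?_some hf
    have h2 := hu I (List.mem_of_find?_eq_some hf) h1
    rw [← h1, ← h2]

theorem List.find?_key_eq_none {α β : Type*} [DecidableEq α] {l : List (α × β)} {a : α}
    (h : ∀ I ∈ l, I.1 ≠ a) : l.find? (fun I => decide (I.1 = a)) = none := by
  rw [List.find?_eq_none]
  intro I hI
  simpa using h I hI

/-! ### Tapes given by two lists -/

namespace Turing.Tape

variable {Γ : Type*} [Inhabited Γ]

theorem mk₂_head (l r : List Γ) : (mk₂ l r).head = r.headI := by
  simp [mk₂]

theorem mk₂_write (l r : List Γ) (b : Γ) : (mk₂ l r).write b = mk₂ l (b :: r.tail) := by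
  simp [mk₂]

theorem mk₂_move_right (l r : List Γ) : (mk₂ l r).move Dir.right = mk₂ (r.headI :: l) r.tail := by
  simp [mk₂]

theorem mk₂_move_left (l r : List Γ) : (mk₂ l r).move Dir.left = mk₂ l.tail (l.headI :: r) := by
  simp [mk₂]

theorem mk₂_left_default (r : List Γ) : mk₂ [default] r = mk₂ [] r := by
  have : ListBlank.mk [default] = ListBlank.mk ([] : List Γ) :=
    Quotient.sound' (Or.inr ⟨1, rfl⟩)
  simp [mk₂, this]

theorem mk₂_right_default (l : List Γ) : mk₂ l [default] = mk₂ l [] := by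
  have : ListBlank.mk [default] = ListBlank.mk ([] : List Γ) :=
    Quotient.sound' (Or.inr ⟨1, rfl⟩)
  simp [mk₂, this]

end Turing.Tape

/-! ### Runs of multitape Turing machines -/

namespace MultitapeTM

variable {M : MultitapeTM}

/-- The configuration `t` steps after `c`. -/
def runFor (M : MultitapeTM) (t : ℕ) (c : Config M) : Config M :=
  (fun c => (M.step c).getD c)^[t] c

/-- From `c`, the machine halts after at most `t` steps. -/
def HaltsFrom (M : MultitapeTM) (t : ℕ) (c : Config M) : Prop :=
  M.step (M.runFor t c) = none

/-- From `c`, the machine halts after at most `t` steps and accepts. -/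
def AcceptsFrom (M : MultitapeTM) (t : ℕ) (c : Config M) : Prop :=
  M.HaltsFrom t c ∧ (M.runFor t c).state = 1

theorem haltsWithin_iff {w : List Bool} {t : ℕ} :
    M.HaltsWithin w t ↔ M.HaltsFrom t (M.init w) := Iff.rfl

theorem acceptsWithin_iff {w : List Bool} {t : ℕ} :
    M.AcceptsWithin w t ↔ M.AcceptsFrom t (M.init w) := Iff.rfl

theorem runFor_of_halted {c : Config M} (h : M.step c = none) (t : ℕ) : M.runFor t c = c := by
  induction t with
  | zero => rfl
  | succ t ih => rw [runFor, Function.iterate_succ_apply, h]; exact ih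

theorem runFor_succ {c c' : Config M} (h : M.step c = some c') (t : ℕ) :
    M.runFor (t + 1) c = M.runFor t c' := by
  rw [runFor, Function.iterate_succ_apply, h]; rfl

theorem haltsFrom_of_halted {c : Config M} (h : M.step c = none) (t : ℕ) : M.HaltsFrom t c := by
  rw [HaltsFrom, runFor_of_halted h, h]

theorem acceptsFrom_of_halted {c : Config M} (h : M.step c = none) (t : ℕ) :
    M.AcceptsFrom t c ↔ c.state = 1 := by
  simp [AcceptsFrom, haltsFrom_of_halted h, runFor_of_halted h]

theorem haltsFrom_succ {c c' : Config M} (h : M.step c = some c') (t : ℕ) :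
    M.HaltsFrom (t + 1) c ↔ M.HaltsFrom t c' := by
  rw [HaltsFrom, HaltsFrom, runFor_succ h]

theorem acceptsFrom_succ {c c' : Config M} (h : M.step c = some c') (t : ℕ) :
    M.AcceptsFrom (t + 1) c ↔ M.AcceptsFrom t c' := by
  rw [AcceptsFrom, AcceptsFrom, haltsFrom_succ h, runFor_succ h]

theorem acceptsFrom_zero {c : Config M} :
    M.AcceptsFrom 0 c ↔ M.step c = none ∧ c.state = 1 := Iff.rfl

theorem HaltsFrom.runFor_eq {c : Config M} {s t : ℕ} (h : M.HaltsFrom s c) (hst : s ≤ t) :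
    M.runFor t c = M.runFor s c := by
  obtain ⟨d, rfl⟩ := Nat.exists_eq_add_of_le' hst
  rw [runFor, Function.iterate_add_apply]
  exact runFor_of_halted h d

theorem HaltsFrom.mono {c : Config M} {s t : ℕ} (h : M.HaltsFrom s c) (hst : s ≤ t) :
    M.HaltsFrom t c := by
  rw [HaltsFrom, h.runFor_eq hst]; exact h

theorem HaltsFrom.acceptsFrom_iff {c : Config M} {s t : ℕ} (h : M.HaltsFrom s c) (hst : s ≤ t) :
    M.AcceptsFrom t c ↔ M.AcceptsFrom s c := by
  simp [AcceptsFrom, h.mono hst, h, h.runFor_eq hst]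

/-- `M.Run n c c'`: from `c`, exactly `n` steps of `M` lead to `c'`. -/
inductive Run (M : MultitapeTM) : ℕ → Config M → Config M → Prop
  | refl (c : Config M) : Run M 0 c c
  | head {n : ℕ} {c c' d : Config M} : M.step c = some c' → Run M n c' d → Run M (n + 1) c d

namespace Run

theorem trans {m n : ℕ} {c d e : Config M} (h : Run M m c d) (h' : Run M n d e) :
    Run M (m + n) c e := by
  induction h with
  | refl => simpa using h'
  | @head k _ _ _ hs _ ih => rw [Nat.add_right_comm]; exact .head hs (ih h')

theorem single {c d : Config M} (h : M.step c = some d) : Run M 1 c d := .head h (.refl d)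

theorem haltsFrom_iff {n : ℕ} {c d : Config M} (h : Run M n c d) (t : ℕ) :
    M.HaltsFrom (n + t) c ↔ M.HaltsFrom t d := by
  induction h with
  | refl => simp
  | @head k _ _ _ hs _ ih => rw [Nat.add_right_comm, haltsFrom_succ hs, ih]

theorem acceptsFrom_iff {n : ℕ} {c d : Config M} (h : Run M n c d) (t : ℕ) :
    M.AcceptsFrom (n + t) c ↔ M.AcceptsFrom t d := by
  induction h with
  | refl => simp
  | @head k _ _ _ hs _ ih =>
    rw [Nat.add_right_comm, acceptsFrom_succ hs, ih]

end Run

end MultitapeTM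

/-! ### The clocked machine

To a machine `M` with `k + 1` tapes we add a unary copy of the input and a clock tape. The clock
tape is first filled with `n ^ 2 + 1` cells of value `c`; then `M` is simulated, and each simulated
step takes one unit off the clock. -/

namespace ClockedTM

open Turing MultitapeTM

/-- The states of the simulated machine. -/
def simState (q : ℕ) : ℕ := if q = 1 then 1 else q + 10

theorem simState_injective : Function.Injective simState := by
  intro a b h; unfold simState at h; split_ifs at h <;> omega

theorem simState_eq_one {q : ℕ} : simState q = 1 ↔ q = 1 := by
  unfold simState; split_ifs <;> omega

/-- The actions `u` on `k + 1` tapes, those without a prescribed action keeping their symbol. -/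
def padActions (k : ℕ) (u : List (ℕ × ℕ)) (r : List ℕ) : List (ℕ × ℕ) :=
  (List.range (k + 1)).map fun i => (u[i]?).getD (r.getD i 0, 0)

/-- The instruction that acts on the first `k + 1` tapes by `u` and on the last two by `x`, `y`. -/
def extInstr (k : ℕ) (q : ℕ) (r : List ℕ) (b m q' : ℕ) (u : List (ℕ × ℕ)) (x y : ℕ × ℕ) :
    TMInstr :=
  ((q, r ++ [b, m]), (q', padActions k u r ++ [x, y]))

/-- The block of instructions for one instruction of the simulated machine. -/
def simBlock (k c : ℕ) (I : TMInstr) : List TMInstr :=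
  extInstr k (simState I.1.1) I.1.2 0 0 5 [] (0, 0) (0, 0) ::
    (List.range c).map fun s => extInstr k (simState I.1.1) I.1.2 0 (s + 1) (simState I.2.1) I.2.2
      (0, 0) (s, if s = 0 then 1 else 0)

/-- The preparation of the clock: for the state and the symbols on the input tape and on its copy,
the new state, the movement on the input tape, and the actions on the last two tapes. -/
def setupTable (c : ℕ) : List ((ℕ × ℕ × ℕ) × (ℕ × ℕ × (ℕ × ℕ) × (ℕ × ℕ))) :=
  [((0, 1, 0), (0, 2, (1, 2), (0, 0))),
   ((0, 2, 0), (0, 2, (1, 2), (0, 0))),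
   ((0, 0, 0), (3, 1, (0, 1), (0, 0))),
   ((3, 1, 1), (3, 0, (1, 1), (c, 2))),
   ((3, 2, 1), (3, 0, (1, 1), (c, 2))),
   ((3, 1, 0), (4, 0, (0, 2), (0, 0))),
   ((3, 2, 0), (4, 0, (0, 2), (0, 0))),
   ((4, 1, 1), (4, 0, (1, 2), (0, 0))),
   ((4, 2, 1), (4, 0, (1, 2), (0, 0))),
   ((4, 1, 0), (3, 1, (0, 1), (0, 0))),
   ((4, 2, 0), (3, 1, (0, 1), (0, 0))),
   ((3, 0, 0), (simState 0, 2, (0, 0), (c, 0))),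
   ((3, 0, 1), (simState 0, 2, (0, 0), (c, 0)))]

/-- The instruction for an entry of `setupTable`. -/
def setupInstr (k : ℕ) (I : (ℕ × ℕ × ℕ) × (ℕ × ℕ × (ℕ × ℕ) × (ℕ × ℕ))) : TMInstr :=
  extInstr k I.1.1 (I.1.2.1 :: List.replicate k 0) I.1.2.2 0 I.2.1 [(I.1.2.1, I.2.2.1)]
    I.2.2.2.1 I.2.2.2.2

/-- The machine `M`, stopped after `c * (n ^ 2 + 1)` steps on inputs of length `n`. -/
def machine (M : MultitapeTM) (c : ℕ) : MultitapeTM :=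
  (M.1 + 2, (setupTable c).map (setupInstr M.1) ++ M.2.flatMap (simBlock M.1 c))

variable {M : MultitapeTM} {c : ℕ}

/-- A family of tapes extended by two more tapes. -/
def extTapes {k : ℕ} (T : Fin (k + 1) → Tape ℕ) (B C : Tape ℕ) : Fin (k + 2 + 1) → Tape ℕ :=
  Fin.snoc (α := fun _ => Tape ℕ) (Fin.snoc (α := fun _ => Tape ℕ) T B) C

theorem extTapes_heads {k : ℕ} (T : Fin (k + 1) → Tape ℕ) (B C : Tape ℕ) :
    (List.ofFn fun i => (extTapes T B C i).head) =
      (List.ofFn fun i => (T i).head) ++ [B.head, C.head] := by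
  rw [List.ofFn_succ', List.ofFn_succ']
  simp only [extTapes, Fin.snoc_castSucc, Fin.snoc_last, List.concat_eq_append, List.append_assoc,
    List.cons_append, List.nil_append]

/-- Padding to exactly `k + 1` entries puts `x` and `y` at the indices of the two extra tapes. A
tape without a prescribed action rewrites its own symbol, which `hr` makes available in `r`. -/
theorem extTapes_act {k : ℕ} {T : Fin (k + 1) → Tape ℕ} {B C : Tape ℕ} {u : List (ℕ × ℕ)}
    {x y : ℕ × ℕ} {r : List ℕ} (hr : r = List.ofFn fun i => (T i).head) :
    (fun i : Fin (k + 2 + 1) => actOn ((padActions k u r ++ [x, y])[(i : ℕ)]?)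
      (extTapes T B C i)) =
    extTapes (fun i => actOn u[(i : ℕ)]? (T i)) (actOn (some x) B) (actOn (some y) C) := by
  have hlen : (padActions k u r).length = k + 1 := by simp [padActions]
  unfold extTapes
  funext i
  refine Fin.lastCases (n := k + 2) ?_ (fun i => ?_) i
  · simp only [Fin.snoc_last, Fin.val_last]
    rw [List.getElem?_append_right (by omega), hlen]
    have : k + 2 - (k + 1) = 1 := by omega
    rw [this]; rfl
  · rw [Fin.snoc_castSucc, Fin.snoc_castSucc]
    refine Fin.lastCases (n := k + 1) ?_ (fun i => ?_) i
    · simp only [Fin.snoc_last, Fin.val_last, Fin.val_castSucc]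
      rw [List.getElem?_append_right (by omega), hlen]
      simp
    · rw [Fin.snoc_castSucc, Fin.snoc_castSucc]
      simp only [Fin.val_castSucc]
      rw [List.getElem?_append_left (by omega)]
      have hi : (i : ℕ) < k + 1 := i.2
      cases hu : u[(i : ℕ)]? with
      | some a => simp [padActions, hu, hi]
      | none => simp [padActions, hu, hi, Nat.lt_succ_iff.1 hi, hr, actOn, moveHead, -List.ofFn_succ]

/-- The configuration with the given state and tapes. -/
def config (M : MultitapeTM) (c q : ℕ) (T : Fin (M.1 + 1) → Tape ℕ) (B C : Tape ℕ) :
    Config (machine M c) where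
  state := q
  tapes := extTapes T B C

theorem config_heads (q : ℕ) (T : Fin (M.1 + 1) → Tape ℕ) (B C : Tape ℕ) :
    (List.ofFn fun i => ((config M c q T B C).tapes i).head) =
      (List.ofFn fun i => (T i).head) ++ [B.head, C.head] :=
  extTapes_heads T B C

theorem config_act {q q' : ℕ} {T : Fin (M.1 + 1) → Tape ℕ} {B C : Tape ℕ} {u : List (ℕ × ℕ)}
    {x y : ℕ × ℕ} {r : List ℕ} (hr : r = List.ofFn fun i => (T i).head) :
    (⟨q', fun i => actOn ((padActions M.1 u r ++ [x, y])[(i : ℕ)]?)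
      ((config M c q T B C).tapes i)⟩ : Config (machine M c)) =
    config M c q' (fun i => actOn u[(i : ℕ)]? (T i)) (actOn (some x) B) (actOn (some y) C) :=
  congrArg (Config.mk (M := machine M c) q') (extTapes_act hr)

theorem extInstr_key {k q r b m q' u x y q₁ r₁ b₁ m₁} :
    (extInstr k q r b m q' u x y).1 = (q₁, r₁ ++ [b₁, m₁]) ↔
      q = q₁ ∧ r = r₁ ∧ b = b₁ ∧ m = m₁ := by
  simp only [extInstr, Prod.mk.injEq]
  constructor
  · rintro ⟨h, h'⟩
    obtain ⟨h1, h2⟩ := List.append_inj' h' rfl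
    simp at h2
    exact ⟨h, h1, h2⟩
  · rintro ⟨rfl, rfl, rfl, rfl⟩; simp

/-- The table lookup of the clocked machine. -/
def lookup (M : MultitapeTM) (c q : ℕ) (r : List ℕ) (b m : ℕ) : Option TMInstr :=
  (machine M c).2.find? fun I => decide (I.1 = (q, r ++ [b, m]))

theorem step_config {q : ℕ} {T : Fin (M.1 + 1) → Tape ℕ} {B C : Tape ℕ} :
    (machine M c).step (config M c q T B C) =
      (lookup M c q (List.ofFn fun i => (T i).head) B.head C.head).map fun I =>
        { state := I.2.1
          tapes := fun i => actOn (I.2.2[(i : ℕ)]?) ((config M c q T B C).tapes i) } := by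
  unfold MultitapeTM.step instr? lookup
  rw [config_heads]; rfl

theorem step_config_of_lookup {q q' : ℕ} {T : Fin (M.1 + 1) → Tape ℕ} {B C : Tape ℕ}
    {u : List (ℕ × ℕ)} {x y : ℕ × ℕ} {q₀ : ℕ} {r₀ r : List ℕ} {b₀ m₀ : ℕ}
    (hr : (List.ofFn fun i => (T i).head) = r)
    (h : lookup M c q r B.head C.head = some (extInstr M.1 q₀ r₀ b₀ m₀ q' u x y)) :
    (machine M c).step (config M c q T B C) =
      some (config M c q' (fun i => actOn u[(i : ℕ)]? (T i))
        (actOn (some x) B) (actOn (some y) C)) := by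
  have hk : (extInstr M.1 q₀ r₀ b₀ m₀ q' u x y).1 = (q, r ++ [B.head, C.head]) := by
    simpa using List.find?_some h
  have hr₀ : r₀ = List.ofFn fun i => (T i).head := (extInstr_key.1 hk).2.1.trans hr.symm
  rw [step_config, hr, h, Option.map_some]
  exact congrArg some (config_act hr₀)

theorem lookup_setup {q a b : ℕ} {I}
    (h : (setupTable c).find? (fun I => decide (I.1 = (q, a, b))) = some I) :
    lookup M c q (a :: List.replicate M.1 0) b 0 = some (setupInstr M.1 I) := by
  have : ((fun I : TMInstr => decide (I.1 = (q, (a :: List.replicate M.1 0) ++ [b, 0]))) ∘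
      setupInstr M.1) = fun I => decide (I.1 = (q, a, b)) := by
    funext I
    simp only [Function.comp, setupInstr, extInstr_key, decide_eq_decide]
    rcases I with ⟨⟨q', a', b'⟩, _⟩
    simp
  rw [lookup, machine, List.find?_append, List.find?_map, this, h]; rfl

/-- The preparation uses only the states 0, 3 and 4, and none of them is a value of `simState`. -/
theorem lookup_sim (q : ℕ) (r : List ℕ) (b m : ℕ) :
    lookup M c (simState q) r b m =
      (M.2.flatMap (simBlock M.1 c)).find?
        fun I => decide (I.1 = (simState q, r ++ [b, m])) := by
  rw [lookup, machine, List.find?_append, List.find?_key_eq_none, Option.none_or]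
  intro I hI hk
  obtain ⟨J, hJ, rfl⟩ := List.mem_map.1 hI
  have h1 := (extInstr_key.1 hk).1
  have h2 : J.1.1 = 0 ∨ J.1.1 = 3 ∨ J.1.1 = 4 := by
    simp only [setupTable, List.mem_cons, List.not_mem_nil, or_false] at hJ
    rcases hJ with rfl | rfl | rfl | rfl | rfl | rfl | rfl | rfl | rfl | rfl | rfl | rfl | rfl <;>
      simp
  unfold simState at h1
  split_ifs at h1 <;> omega

theorem find_simBlock_of_ne {k q : ℕ} {r : List ℕ} {b m : ℕ} {I : TMInstr} (h : I.1 ≠ (q, r)) :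
    (simBlock k c I).find? (fun I => decide (I.1 = (simState q, r ++ [b, m]))) = none := by
  apply List.find?_key_eq_none
  intro J hJ hk
  apply h
  have : simState I.1.1 = simState q ∧ I.1.2 = r := by
    simp only [simBlock, List.mem_cons, List.mem_map] at hJ
    rcases hJ with rfl | ⟨s, _, rfl⟩
    · exact ⟨(extInstr_key.1 hk).1, (extInstr_key.1 hk).2.1⟩
    · exact ⟨(extInstr_key.1 hk).1, (extInstr_key.1 hk).2.1⟩
  exact Prod.ext (simState_injective this.1) this.2

theorem find_flatMap_simBlock {q : ℕ} {r : List ℕ} {b m : ℕ} {k : ℕ} (P : List TMInstr) :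
    (P.flatMap (simBlock k c)).find? (fun I => decide (I.1 = (simState q, r ++ [b, m]))) = none ∨
    ∃ I, P.find? (fun I => decide (I.1 = (q, r))) = some I := by
  induction P with
  | nil => simp
  | cons I P ih =>
    by_cases h : I.1 = (q, r)
    · right; exact ⟨I, by simp [h]⟩
    · rw [List.flatMap_cons, List.find?_append, find_simBlock_of_ne h, Option.none_or]
      simpa [h] using ih

/-- Blocks of instructions with different keys have no key in common, so the rule that the first
applicable instruction counts survives the translation. -/
theorem find_flatMap_simBlock_of_find {q : ℕ} {r : List ℕ} {b m k : ℕ} {P : List TMInstr}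
    {I J : TMInstr}
    (h : P.find? (fun I => decide (I.1 = (q, r))) = some I)
    (hJ : (simBlock k c I).find? (fun I => decide (I.1 = (simState q, r ++ [b, m]))) = some J) :
    (P.flatMap (simBlock k c)).find? (fun I => decide (I.1 = (simState q, r ++ [b, m]))) =
      some J := by
  induction P with
  | nil => simp at h
  | cons I' P ih =>
    rw [List.flatMap_cons, List.find?_append]
    by_cases h' : I'.1 = (q, r)
    · have : I' = I := by simpa [h'] using h
      rw [this, hJ]; rfl
    · rw [find_simBlock_of_ne h', Option.none_or]
      exact ih (by simpa [h'] using h)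

theorem find_simBlock_zero {k : ℕ} (I : TMInstr) :
    (simBlock k c I).find? (fun J => decide (J.1 = (simState I.1.1, I.1.2 ++ [0, 0]))) =
      some (extInstr k (simState I.1.1) I.1.2 0 0 5 [] (0, 0) (0, 0)) := by
  rw [simBlock, List.find?_cons_of_pos]
  simp [extInstr]

theorem find_simBlock_succ {k s : ℕ} (hs : s < c) (I : TMInstr) :
    (simBlock k c I).find? (fun J => decide (J.1 = (simState I.1.1, I.1.2 ++ [0, s + 1]))) =
      some (extInstr k (simState I.1.1) I.1.2 0 (s + 1) (simState I.2.1) I.2.2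
        (0, 0) (s, if s = 0 then 1 else 0)) := by
  refine List.find?_key_eq_some (a := (simState I.1.1, I.1.2 ++ [0, s + 1])) ?_ ?_
  · simp only [simBlock, List.mem_cons, List.mem_map]
    exact Or.inr ⟨s, by simpa using hs, rfl⟩
  · intro J hJ hk
    simp only [simBlock, List.mem_cons, List.mem_map] at hJ
    rcases hJ with rfl | ⟨s', _, rfl⟩
    · simp [extInstr] at hk
    · have := (extInstr_key.1 hk).2.2.2
      obtain rfl : s' = s := by omega
      rfl

/-- `ClockAt c v C`: the clock tape `C` shows that `v` units are left. -/
def ClockAt (c v : ℕ) (C : Tape ℕ) : Prop :=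
  ∃ (s j : ℕ) (r : List ℕ), C = Tape.mk₂ (List.replicate j c) (s :: r) ∧ s ≤ c ∧
    (s = 0 → c * j = 0) ∧ v = s + c * j

theorem ClockAt.head_eq_zero {C : Tape ℕ} (h : ClockAt c 0 C) : C.head = 0 := by
  obtain ⟨s, j, r, rfl, -, -, hv⟩ := h
  rw [Tape.mk₂_head]; simp only [List.headI]; omega

/-- When the current cell drops to 0, the head moves to the next cell on the left in the same step.
Hence it reads 0 only when the whole clock is used up. -/
theorem ClockAt.tick {v : ℕ} {C : Tape ℕ} (h : ClockAt c (v + 1) C) :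
    ∃ s, C.head = s + 1 ∧ s < c ∧
      ClockAt c v (actOn (some (s, if s = 0 then 1 else 0)) C) := by
  obtain ⟨s, j, r, rfl, hs, h0, hv⟩ := h
  have hs0 : s ≠ 0 := fun h => by have := h0 h; omega
  obtain ⟨s, rfl⟩ := Nat.exists_eq_succ_of_ne_zero hs0
  refine ⟨s, by simp [Tape.mk₂_head], by omega, ?_⟩
  by_cases hz : s = 0
  · subst hz
    simp only [actOn, moveHead, if_true, Tape.mk₂_write, Tape.mk₂_move_left, List.tail_cons]
    cases j with
    -- No cell is left: the head arrives on the blank to the left of the clock, which counts as a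
    -- cell of value 0.
    | zero => exact ⟨0, 0, [0] ++ r, by simp, by omega, by simp, by simpa using hv⟩
    | succ j =>
      refine ⟨c, j, 0 :: r, by simp [List.replicate_succ], le_rfl, by rintro rfl; simp, ?_⟩
      rw [Nat.mul_succ] at hv; omega
  · simp only [actOn, hz, if_false, moveHead, Tape.mk₂_write, List.tail_cons]
    exact ⟨s, j, r, rfl, by omega, fun h => absurd h hz, by omega⟩

/-- The configuration of the clocked machine in the simulation. -/
def simConfig (c : ℕ) (d : Config M) (B C : Tape ℕ) : Config (machine M c) :=
  config M c (simState d.state) d.tapes B C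

theorem step_simConfig_of_none {d : Config M} {B C : Tape ℕ} (h : M.step d = none) :
    (machine M c).step (simConfig c d B C) = none := by
  rw [simConfig, step_config, lookup_sim]
  rcases find_flatMap_simBlock (c := c) (q := d.state)
    (r := List.ofFn fun i => (d.tapes i).head) (b := B.head) (m := C.head) (k := M.1) M.2
    with h' | ⟨I, h'⟩
  · rw [h']; rfl
  · have : M.instr? d = none := by
      unfold MultitapeTM.step at h
      exact Option.map_eq_none_iff.1 h
    rw [instr?, h'] at this
    cases this

theorem step_simConfig_timeout {d d' : Config M} {B C : Tape ℕ} (h : M.step d = some d')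
    (hB : B.head = 0) (hC : C.head = 0) :
    ∃ T B' C', (machine M c).step (simConfig c d B C) = some (config M c 5 T B' C') := by
  unfold MultitapeTM.step at h
  obtain ⟨I, hI, -⟩ := Option.map_eq_some_iff.1 h
  have hk : I.1 = (d.state, List.ofFn fun i => (d.tapes i).head) := by
    simpa using List.find?_some hI
  have hl : lookup M c (simState d.state) (List.ofFn fun i => (d.tapes i).head) B.head C.head =
      some (extInstr M.1 (simState I.1.1) I.1.2 0 0 5 [] (0, 0) (0, 0)) := by
    rw [lookup_sim, hB, hC]
    refine find_flatMap_simBlock_of_find hI ?_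
    have := find_simBlock_zero (c := c) (k := M.1) I
    rw [hk] at this ⊢
    exact this
  exact ⟨_, _, _, step_config_of_lookup rfl hl⟩

theorem step_simConfig {d d' : Config M} {B C : Tape ℕ} {s : ℕ} (h : M.step d = some d')
    (hB : B.head = 0) (hC : C.head = s + 1) (hs : s < c) :
    (machine M c).step (simConfig c d B C) =
      some (simConfig c d' B (actOn (some (s, if s = 0 then 1 else 0)) C)) := by
  unfold MultitapeTM.step at h
  obtain ⟨I, hI, rfl⟩ := Option.map_eq_some_iff.1 h
  have hk : I.1 = (d.state, List.ofFn fun i => (d.tapes i).head) := by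
    simpa using List.find?_some hI
  have hl : lookup M c (simState d.state) (List.ofFn fun i => (d.tapes i).head) B.head C.head =
      some (extInstr M.1 (simState I.1.1) I.1.2 0 (s + 1) (simState I.2.1) I.2.2
        (0, 0) (s, if s = 0 then 1 else 0)) := by
    rw [lookup_sim, hB, hC]
    refine find_flatMap_simBlock_of_find hI ?_
    have := find_simBlock_succ (c := c) (k := M.1) hs I
    rw [hk] at this ⊢
    exact this
  rw [simConfig, step_config_of_lookup rfl hl]
  have : actOn (some (0, 0)) B = B := by
    have h := Tape.write_self B
    rw [hB] at h
    simpa [actOn, moveHead] using h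
  rw [this]; rfl

theorem step_config_reject {T : Fin (M.1 + 1) → Tape ℕ} {B C : Tape ℕ} :
    (machine M c).step (config M c 5 T B C) = none := by
  rw [step_config, lookup, List.find?_key_eq_none, Option.map_none]
  intro I hI hk
  simp only [machine, List.mem_append, List.mem_map, List.mem_flatMap] at hI
  rcases hI with ⟨J, hJ, rfl⟩ | ⟨J, hJ, hI⟩
  · have h1 := (extInstr_key.1 hk).1
    simp only [setupTable, List.mem_cons, List.not_mem_nil, or_false] at hJ
    rcases hJ with rfl | rfl | rfl | rfl | rfl | rfl | rfl | rfl | rfl | rfl | rfl | rfl | rfl <;>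
      simp at h1
  · have h1 : simState J.1.1 = 5 := by
      simp only [simBlock, List.mem_cons, List.mem_map] at hI
      rcases hI with rfl | ⟨s, _, rfl⟩ <;> exact (extInstr_key.1 hk).1
    unfold simState at h1; split_ifs at h1 <;> omega

/-- The extra step is the move to the rejecting state 5, made when the clock is empty and `M` would
still go on. Acceptance is preserved since 1 is the only state that `simState` sends to 1. -/
theorem simulation {v : ℕ} : ∀ {d : Config M} {B C : Tape ℕ}, B.head = 0 → ClockAt c v C →
    (machine M c).HaltsFrom (v + 1) (simConfig c d B C) ∧
      ((machine M c).AcceptsFrom (v + 1) (simConfig c d B C) ↔ M.AcceptsFrom v d) := by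
  -- Where `M` has no instruction, the clocked machine has none either, whatever the clock shows; so
  -- the two time bounds are independent here.
  have halted : ∀ {d : Config M} {B C : Tape ℕ} (v w : ℕ), M.step d = none →
      (machine M c).HaltsFrom w (simConfig c d B C) ∧
      ((machine M c).AcceptsFrom w (simConfig c d B C) ↔ M.AcceptsFrom v d) := by
    intro d B C v w h
    have h' := step_simConfig_of_none (c := c) (B := B) (C := C) h
    refine ⟨haltsFrom_of_halted h' _, ?_⟩
    rw [acceptsFrom_of_halted h', acceptsFrom_of_halted h]
    exact simState_eq_one
  induction v with
  | zero =>
    intro d B C hB hC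
    cases h : M.step d with
    | none => exact halted 0 1 h
    | some d' =>
      obtain ⟨T, B', C', h'⟩ := step_simConfig_timeout (c := c) h hB hC.head_eq_zero
      rw [haltsFrom_succ h', acceptsFrom_succ h']
      refine ⟨step_config_reject, iff_of_false ?_ ?_⟩
      · rw [acceptsFrom_of_halted step_config_reject]; simp [config]
      · rw [acceptsFrom_zero, h]; simp
  | succ v ih =>
    intro d B C hB hC
    cases h : M.step d with
    | none => exact halted (v + 1) (v + 1 + 1) h
    | some d' =>
      obtain ⟨s, hs, hsc, hC'⟩ := hC.tick
      have h' := step_simConfig (c := c) h hB hs hsc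
      rw [haltsFrom_succ h', acceptsFrom_succ h', acceptsFrom_succ h]
      exact ih hB hC'

/-- The configuration in the preparation of the clock. -/
def setupConfig (M : MultitapeTM) (c q : ℕ) (T B C : Tape ℕ) : Config (machine M c) :=
  config M c q (fun i => if (i : ℕ) = 0 then T else Tape.mk₂ [] []) B C

theorem step_setupConfig {q q' b d₀ : ℕ} {x y : ℕ × ℕ} {T B C : Tape ℕ} (hC : C.head = 0)
    (hB : B.head = b) (h : (setupTable c).find? (fun I => decide (I.1 = (q, T.head, b))) =
      some ((q, T.head, b), (q', d₀, x, y))) :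
    (machine M c).step (setupConfig M c q T B C) =
      some (setupConfig M c q' (moveHead d₀ T) (actOn (some x) B) (actOn (some y) C)) := by
  have hl := lookup_setup (M := M) h
  have hr : (List.ofFn fun i : Fin (M.1 + 1) =>
      (if (i : ℕ) = 0 then T else Tape.mk₂ [] []).head) = T.head :: List.replicate M.1 0 := by
    rw [List.ofFn_succ]
    simp [Tape.mk₂_head, List.ofFn_const]
  have hl' : lookup M c q (T.head :: List.replicate M.1 0) B.head C.head =
      some (setupInstr M.1 ((q, T.head, b), q', d₀, x, y)) := by
    rw [hB, hC]; exact hl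
  rw [setupConfig, step_config_of_lookup hr hl']
  unfold setupConfig
  congr 2
  funext i
  by_cases hi : (i : ℕ) = 0
  · simp [hi, actOn]
  · obtain ⟨j, hj⟩ := Nat.exists_eq_succ_of_ne_zero hi
    simp [hj, actOn]

theorem blank_eq_extTapes {k : ℕ} (l : List ℕ) :
    (fun i : Fin (k + 2 + 1) => Tape.mk₁ (if (i : ℕ) = 0 then l else [])) =
      extTapes (fun i : Fin (k + 1) => if (i : ℕ) = 0 then Tape.mk₂ [] l else Tape.mk₂ [] [])
        (Tape.mk₂ [] []) (Tape.mk₂ [] []) := by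
  unfold extTapes
  funext i
  refine Fin.lastCases (n := k + 2) ?_ (fun i => ?_) i
  · simp [Tape.mk₁]
  · rw [Fin.snoc_castSucc]
    refine Fin.lastCases (n := k + 1) ?_ (fun i => ?_) i
    · simp [Tape.mk₁]
    · rw [Fin.snoc_castSucc]
      by_cases hi : (i : ℕ) = 0 <;> simp [hi, Tape.mk₁]

theorem init_eq (w : List Bool) : (machine M c).init w =
    setupConfig M c 0 (Tape.mk₂ [] (w.map fun b => cond b 2 1)) (Tape.mk₂ [] [])
      (Tape.mk₂ [] []) :=
  congrArg (Config.mk (M := machine M c) 0) (blank_eq_extTapes _)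

end ClockedTM

/-! ### Running the preparation of the clock -/

namespace ClockedTM

open Turing MultitapeTM

variable {M : MultitapeTM} {c : ℕ}

theorem step_copy {T C : Tape ℕ} {i : ℕ} (hC : C.head = 0) (hT : T.head = 1 ∨ T.head = 2) :
    (machine M c).step (setupConfig M c 0 T (Tape.mk₂ (List.replicate i 1) []) C) =
      some (setupConfig M c 0 (T.move Dir.right) (Tape.mk₂ (List.replicate (i + 1) 1) []) C) := by
  have hC' : actOn (some (0, 0)) C = C := by
    have h := Tape.write_self C
    rw [hC] at h
    simpa [actOn, moveHead] using h
  have hB : actOn (some (1, 2)) (Tape.mk₂ (List.replicate i 1) []) =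
      Tape.mk₂ (List.replicate (i + 1) 1) [] := by
    simp [actOn, moveHead, Tape.mk₂_write, Tape.mk₂_move_right, List.replicate_succ]
  have h := step_setupConfig (M := M) (c := c) (q := 0) (q' := 0) (b := 0) (d₀ := 2) (x := (1, 2))
    (y := (0, 0)) (T := T) (B := Tape.mk₂ (List.replicate i 1) []) hC (by simp [Tape.mk₂_head])
    (by rcases hT with h | h <;> rw [h] <;> rfl)
  rw [h, hC', hB]; rfl

theorem run_copy {C : Tape ℕ} (hC : C.head = 0) (r : List ℕ) :
    ∀ (l : List ℕ) (i : ℕ), (∀ a ∈ r, a = 1 ∨ a = 2) →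
    Run (machine M c) r.length
      (setupConfig M c 0 (Tape.mk₂ l r) (Tape.mk₂ (List.replicate i 1) []) C)
      (setupConfig M c 0 (Tape.mk₂ (r.reverse ++ l) [])
        (Tape.mk₂ (List.replicate (i + r.length) 1) []) C) := by
  induction r with
  | nil => intro l i _; exact .refl _
  | cons a r ih =>
    intro l i h
    have h' := ih (a :: l) (i + 1) fun b hb => h b (List.mem_cons_of_mem _ hb)
    refine .head (step_copy hC (by simpa [Tape.mk₂_head] using h a List.mem_cons_self)) ?_
    rw [Tape.mk₂_move_right]
    simpa [Nat.add_assoc, Nat.add_comm 1] using h'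

/-- The unary copy of an input of length `n`, with the head on its last mark. -/
def copyTape (n : ℕ) : Tape ℕ := (Tape.mk₂ (List.replicate n 1) []).move Dir.left

/-- The clock tape after `j` cells have been written. -/
def clockTape (c j : ℕ) : Tape ℕ := Tape.mk₂ (List.replicate j c) []

theorem clockTape_head (c j : ℕ) : (clockTape c j).head = 0 := by
  simp [clockTape, Tape.mk₂_head]

theorem clockTape_act_zero (j : ℕ) : actOn (some (0, 0)) (clockTape c j) = clockTape c j := by
  have h := Tape.write_self (clockTape c j)
  rw [clockTape_head] at h
  simpa [actOn, moveHead] using h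

theorem clockTape_act (j : ℕ) : actOn (some (c, 2)) (clockTape c j) = clockTape c (j + 1) := by
  simp [actOn, moveHead, clockTape, Tape.mk₂_write, Tape.mk₂_move_right, List.replicate_succ]

theorem step_copy_end {T : Tape ℕ} {n : ℕ} (hT : T.head = 0) :
    (machine M c).step (setupConfig M c 0 T (Tape.mk₂ (List.replicate n 1) []) (clockTape c 0)) =
      some (setupConfig M c 3 (T.move Dir.left) (copyTape n) (clockTape c 0)) := by
  have h := step_setupConfig (M := M) (c := c) (q := 0) (q' := 3) (b := 0) (d₀ := 1) (x := (0, 1))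
    (y := (0, 0)) (T := T) (B := Tape.mk₂ (List.replicate n 1) []) (clockTape_head c 0)
    (by simp [Tape.mk₂_head]) (by rw [hT]; rfl)
  rw [h, clockTape_act_zero]
  have : (Tape.mk₂ (List.replicate n 1) []).write 0 = Tape.mk₂ (List.replicate n 1) [] := by
    conv_rhs => rw [← Tape.write_self (Tape.mk₂ (List.replicate n 1) [])]
    rw [Tape.mk₂_head]; rfl
  simp only [actOn, this]; rfl

/-- The sweep to the left over the copy writes one cell of the clock for each mark. -/
theorem run_sweep_left {T : Tape ℕ} (hT : T.head = 1 ∨ T.head = 2) (p : ℕ) :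
    ∀ q j : ℕ, Run (machine M c) (p + 1)
      (setupConfig M c 3 T (Tape.mk₂ (List.replicate p 1) (List.replicate (q + 1) 1))
        (clockTape c j))
      (setupConfig M c 3 T (Tape.mk₂ [] (0 :: List.replicate (p + q + 1) 1))
        (clockTape c (j + p + 1))) := by
  have step : ∀ p q j : ℕ, (machine M c).step
      (setupConfig M c 3 T (Tape.mk₂ (List.replicate p 1) (List.replicate (q + 1) 1))
        (clockTape c j)) = some (setupConfig M c 3 T ((Tape.mk₂ (List.replicate p 1)
          (List.replicate (q + 1) 1)).move Dir.left) (clockTape c (j + 1))) := by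
    intro p q j
    have h := step_setupConfig (M := M) (c := c) (q := 3) (q' := 3) (b := 1) (d₀ := 0)
      (x := (1, 1)) (y := (c, 2)) (T := T)
      (B := Tape.mk₂ (List.replicate p 1) (List.replicate (q + 1) 1)) (clockTape_head c j)
      (by simp [Tape.mk₂_head, List.replicate_succ])
      (by rcases hT with h | h <;> rw [h] <;> rfl)
    rw [h, clockTape_act]
    simp [actOn, moveHead, Tape.mk₂_write, List.replicate_succ]
  induction p with
  | zero =>
    intro q j
    refine .single ((step 0 q j).trans ?_)
    simp [Tape.mk₂_move_left]
  | succ p ih =>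
    intro q j
    refine .head (step (p + 1) q j) ?_
    have := ih (q + 1) (j + 1)
    rw [Tape.mk₂_move_left]
    convert this using 3 <;> first | rfl | omega | (congr 2; omega)

/-- The sweep back to the right. -/
theorem run_sweep_right {T : Tape ℕ} (hT : T.head = 1 ∨ T.head = 2) (j q : ℕ) :
    ∀ p : ℕ, Run (machine M c) q
      (setupConfig M c 4 T (Tape.mk₂ (List.replicate p 1) (List.replicate q 1)) (clockTape c j))
      (setupConfig M c 4 T (Tape.mk₂ (List.replicate (p + q) 1) []) (clockTape c j)) := by
  induction q with
  | zero => intro p; exact .refl _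
  | succ q ih =>
    intro p
    have h := step_setupConfig (M := M) (c := c) (q := 4) (q' := 4) (b := 1) (d₀ := 0)
      (x := (1, 2)) (y := (0, 0)) (T := T)
      (B := Tape.mk₂ (List.replicate p 1) (List.replicate (q + 1) 1)) (clockTape_head c j)
      (by simp [Tape.mk₂_head, List.replicate_succ])
      (by rcases hT with h | h <;> rw [h] <;> rfl)
    refine .head h ?_
    have := ih (p + 1)
    rw [clockTape_act_zero]
    rw [show p + (q + 1) = p + 1 + q by omega]
    simpa [actOn, moveHead, Tape.mk₂_write, List.replicate_succ, Tape.mk₂_move_right] using this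

/-- One letter of the input makes the clock grow by `n` cells. -/
theorem run_round {T : Tape ℕ} (hT : T.head = 1 ∨ T.head = 2) (n j : ℕ) (hn : 0 < n) :
    Run (machine M c) (2 * n + 2) (setupConfig M c 3 T (copyTape n) (clockTape c j))
      (setupConfig M c 3 (T.move Dir.left) (copyTape n) (clockTape c (j + n))) := by
  obtain ⟨p, rfl⟩ := Nat.exists_eq_succ_of_ne_zero hn.ne'
  have e : copyTape (p + 1) = Tape.mk₂ (List.replicate p 1) (List.replicate (0 + 1) 1) := by
    rw [copyTape, Tape.mk₂_move_left]
    have := Tape.mk₂_right_default (Γ := ℕ)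
    simp [List.replicate_succ]
  have h1 := run_sweep_left (M := M) (c := c) hT p 0 j
  have h2 := step_setupConfig (M := M) (c := c) (q := 3) (q' := 4) (b := 0) (d₀ := 0)
      (x := (0, 2)) (y := (0, 0)) (T := T)
      (B := Tape.mk₂ [] (0 :: List.replicate (p + 0 + 1) 1)) (clockTape_head c (j + p + 1))
      (by simp [Tape.mk₂_head]) (by rcases hT with h | h <;> rw [h] <;> rfl)
  -- Coming back from the blank before the copy leaves a single blank on the left, which does not
  -- change the tape.
  have e2 : actOn (some (0, 2)) (Tape.mk₂ [] (0 :: List.replicate (p + 0 + 1) 1)) =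
      Tape.mk₂ (List.replicate 0 1) (List.replicate (p + 1) 1) := by
    simp only [actOn, moveHead, Tape.mk₂_write, Tape.mk₂_move_right, List.tail_cons, List.headI]
    exact Tape.mk₂_left_default _
  rw [clockTape_act_zero, e2] at h2
  have h3 := run_sweep_right (M := M) (c := c) hT (j + p + 1) (p + 1) 0
  have h4 := step_setupConfig (M := M) (c := c) (q := 4) (q' := 3) (b := 0) (d₀ := 1)
      (x := (0, 1)) (y := (0, 0)) (T := T)
      (B := Tape.mk₂ (List.replicate (0 + (p + 1)) 1) []) (clockTape_head c (j + p + 1))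
      (by simp [Tape.mk₂_head]) (by rcases hT with h | h <;> rw [h] <;> rfl)
  have e4 : actOn (some (0, 1)) (Tape.mk₂ (List.replicate (0 + (p + 1)) 1) []) =
      copyTape (p + 1) := by
    rw [copyTape, Nat.zero_add]
    have : (Tape.mk₂ (List.replicate (p + 1) 1) []).write 0 =
        Tape.mk₂ (List.replicate (p + 1) 1) [] := by
      conv_rhs => rw [← Tape.write_self (Tape.mk₂ (List.replicate (p + 1) 1) [])]
      rw [Tape.mk₂_head]; rfl
    simp only [actOn, this]; rfl
  rw [clockTape_act_zero, e4] at h4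
  rw [← e] at h1
  have := ((h1.trans (.single h2)).trans h3).trans (.single h4)
  convert this using 1
  · omega
  · rfl

theorem run_rounds (n : ℕ) (hn : 0 < n) (l : List ℕ) :
    ∀ (r : List ℕ) (j : ℕ), (∀ a ∈ l, a = 1 ∨ a = 2) →
    Run (machine M c) ((2 * n + 2) * l.length)
      (setupConfig M c 3 ((Tape.mk₂ l r).move Dir.left) (copyTape n) (clockTape c j))
      (setupConfig M c 3 ((Tape.mk₂ [] (l.reverse ++ r)).move Dir.left) (copyTape n)
        (clockTape c (j + n * l.length))) := by
  induction l with
  | nil => intro r j _; exact .refl _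
  | cons a l ih =>
    intro r j h
    rw [Tape.mk₂_move_left, List.length_cons, Nat.mul_succ, Nat.mul_succ,
      Nat.add_comm ((2 * n + 2) * l.length), Nat.add_comm (n * l.length), ← Nat.add_assoc]
    refine (run_round (by simpa [Tape.mk₂_head] using h a List.mem_cons_self) n j hn).trans ?_
    have := ih (a :: r) (j + n) fun b hb => h b (List.mem_cons_of_mem _ hb)
    simpa using this

theorem copyTape_head (n : ℕ) : (copyTape n).head = 0 ∨ (copyTape n).head = 1 := by
  rw [copyTape, Tape.mk₂_move_left, Tape.mk₂_head]
  cases n <;> simp [List.replicate_succ]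

/-- The cell written under the head accounts for the `+ 1` in the time bound. The copy tape gets a 0
because the simulation expects to read 0 there; it showed 0 already when the input is empty. -/
theorem step_setup_end {T : Tape ℕ} {n : ℕ} (hT : T.head = 0) (j : ℕ) :
    ∃ B C, (machine M c).step (setupConfig M c 3 T (copyTape n) (clockTape c j)) =
      some (setupConfig M c (simState 0) (T.move Dir.right) B C) ∧ B.head = 0 ∧
        ClockAt c (c * (j + 1)) C := by
  obtain ⟨b, hb, hf⟩ : ∃ b, (copyTape n).head = b ∧
      (setupTable c).find? (fun I => decide (I.1 = (3, T.head, b))) =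
        some ((3, T.head, b), (simState 0, 2, (0, 0), (c, 0))) := by
    rcases copyTape_head n with h | h
    · exact ⟨0, h, by rw [hT]; rfl⟩
    · exact ⟨1, h, by rw [hT]; rfl⟩
  refine ⟨_, _, step_setupConfig (clockTape_head c j) hb hf, rfl, c, j, [], ?_, le_rfl, ?_, ?_⟩
  · simp [actOn, moveHead, clockTape, Tape.mk₂_write]
  · rintro rfl; simp
  · ring

theorem run_setup (w : List Bool) : ∃ B C,
    Run (machine M c) (w.length + 1 + (2 * w.length + 2) * w.length + 1)
      ((machine M c).init w) (simConfig c (M.init w) B C) ∧ B.head = 0 ∧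
      ClockAt c (c * (w.length ^ 2 + 1)) C := by
  set W := w.map fun b => cond b 2 1 with hW
  have hlen : W.length = w.length := by simp [hW]
  have hmem : ∀ a ∈ W, a = 1 ∨ a = 2 := by
    intro a ha
    obtain ⟨b, -, rfl⟩ := List.mem_map.1 ha
    cases b <;> simp
  have h1 := run_copy (M := M) (c := c) (clockTape_head c 0) W [] 0 hmem
  have h2 := step_copy_end (M := M) (c := c) (T := Tape.mk₂ W.reverse []) (n := W.length)
    (by simp [Tape.mk₂_head])
  have h3 : Run (machine M c) ((2 * W.length + 2) * W.length)
      (setupConfig M c 3 ((Tape.mk₂ W.reverse []).move Dir.left) (copyTape W.length)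
        (clockTape c 0))
      (setupConfig M c 3 ((Tape.mk₂ [] W).move Dir.left) (copyTape W.length)
        (clockTape c (W.length * W.length))) := by
    -- A round presupposes a mark on the copy tape; for the empty input there are no rounds.
    rcases Nat.eq_zero_or_pos W.length with h0 | hpos
    · rw [List.length_eq_zero_iff.1 h0]; exact .refl _
    · have := run_rounds (M := M) (c := c) W.length hpos W.reverse [] 0
        fun a ha => hmem a (List.mem_reverse.1 ha)
      simpa using this
  obtain ⟨B, C, h4, hB, hC⟩ := step_setup_end (M := M) (c := c) (n := W.length)
    (T := (Tape.mk₂ [] W).move Dir.left) (by simp [Tape.mk₂_move_left, Tape.mk₂_head])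
    (W.length * W.length)
  refine ⟨B, C, ?_, hB, by rw [sq, ← hlen]; exact hC⟩
  rw [init_eq, ← hlen]
  have e : simConfig c (M.init w) B C = setupConfig M c (simState 0)
      (((Tape.mk₂ [] W).move Dir.left).move Dir.right) B C := by
    rw [Tape.move_left_right]
    unfold simConfig setupConfig
    congr 1
    funext i
    change Tape.mk₁ (if (i : ℕ) = 0 then W else []) =
      if (i : ℕ) = 0 then Tape.mk₂ [] W else Tape.mk₂ [] []
    split_ifs <;> rfl
  rw [e]
  rw [List.append_nil, Nat.zero_add] at h1
  exact ((h1.trans (.single h2)).trans h3).trans (.single h4)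

/-- The preparation takes 2 * n ^ 2 + 3 * n + 2 steps and the simulation at most c * (n ^ 2 + 1) +
1. By n ≤ n ^ 2 the additional 8 in the constant is more than enough. -/
theorem machine_spec (M : MultitapeTM) (c : ℕ) (w : List Bool) :
    (machine M c).HaltsWithin w ((c + 8) * (w.length ^ 2 + 1)) ∧
      (w ∈ clockedLanguage (fun n => n ^ 2) M c ↔
        (machine M c).AcceptsWithin w ((c + 8) * (w.length ^ 2 + 1))) := by
  obtain ⟨B, C, hrun, hB, hC⟩ := run_setup (M := M) (c := c) w
  obtain ⟨h1, h2⟩ := simulation (d := M.init w) hB hC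
  set n := w.length
  have hle : (n + 1 + (2 * n + 2) * n + 1) + (c * (n ^ 2 + 1) + 1) ≤
      (c + 8) * (n ^ 2 + 1) := by 
    nlinarith [Nat.le_self_pow two_ne_zero n]
  have h3 := (hrun.haltsFrom_iff _).2 h1
  rw [haltsWithin_iff, acceptsWithin_iff, h3.acceptsFrom_iff hle, hrun.acceptsFrom_iff, h2]
  exact ⟨h3.mono hle, Iff.rfl⟩

end ClockedTM

/-! ### The clocked languages are exactly the quadratic-time computable ones -/

theorem range_quadLang : Set.range quadLang = DTIME (fun n => n ^ 2) := by
  apply Set.Subset.antisymm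
  · rintro _ ⟨e, rfl⟩
    exact ⟨_, _, ClockedTM.machine_spec _ _⟩
  · rintro L ⟨M, c, h⟩
    refine ⟨Encodable.encode (M, c), Set.ext fun w => ?_⟩
    rw [(h w).2, quadLang, Denumerable.ofNat_encode]
    rfl

/-! ### Computable simulation -/

theorem Primrec.list_find? {α β : Type*} [Primcodable α] [Primcodable β] {f : α → List β}
    {p : α → β → Bool} (hf : Primrec f) (hp : Primrec₂ p) :
    Primrec fun a => (f a).find? (p a) := by
  refine (Primrec.list_getElem?.comp hf (Primrec.list_findIdx hf hp)).of_eq fun a => ?_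
  generalize f a = l
  induction l with
  | nil => rfl
  | cons b l ih => by_cases h : p a b = true <;> simp_all [List.findIdx_cons]

namespace MultitapeTM

open Turing

/-- A tape, given by the part to the left of the head and the rest. -/
abbrev ListTape : Type := List ℕ × List ℕ

/-- A state and finitely many tapes; the further tapes are blank. -/
abbrev ListConfig : Type := ℕ × List ListTape

namespace ListTape

/-- The tape described by two lists. -/
def toTape (T : ListTape) : Tape ℕ := Tape.mk₂ T.1 T.2

/-- Head movement. -/
def moveHead (d : ℕ) (T : ListTape) : ListTape :=
  if d = 0 then T
  else if d = 1 then (T.1.tail, T.1.headI :: T.2)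
  else (T.2.headI :: T.1, T.2.tail)

/-- Write and move. -/
def actOn (u : Option (ℕ × ℕ)) (T : ListTape) : ListTape :=
  Option.casesOn u T fun a => moveHead a.2 (T.1, a.1 :: T.2.tail)

theorem toTape_moveHead (d : ℕ) (T : ListTape) :
    (moveHead d T).toTape = MultitapeTM.moveHead d T.toTape := by
  match d with
  | 0 => rfl
  | 1 => exact (Tape.mk₂_move_left _ _).symm
  | d + 2 => exact (Tape.mk₂_move_right _ _).symm

theorem toTape_actOn (u : Option (ℕ × ℕ)) (T : ListTape) :
    (actOn u T).toTape = MultitapeTM.actOn u T.toTape := by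
  match u with
  | none => rfl
  | some (a, d) =>
    refine (toTape_moveHead d _).trans ?_
    simp only [MultitapeTM.actOn, toTape, Tape.mk₂_write]

theorem moveHead_primrec : Primrec₂ moveHead := by
  have hT : Primrec fun x : ℕ × ListTape => x.2 := Primrec.snd
  refine Primrec.ite (Primrec.eq.comp Primrec.fst (Primrec.const 0)) hT
    (Primrec.ite (Primrec.eq.comp Primrec.fst (Primrec.const 1)) ?_ ?_)
  · exact (Primrec.list_tail.comp (Primrec.fst.comp hT)).pair
      (Primrec.list_cons.comp (Primrec.list_headI.comp (Primrec.fst.comp hT))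
        (Primrec.snd.comp hT))
  · exact (Primrec.list_cons.comp (Primrec.list_headI.comp (Primrec.snd.comp hT))
      (Primrec.fst.comp hT)).pair (Primrec.list_tail.comp (Primrec.snd.comp hT))

theorem actOn_primrec : Primrec₂ actOn := by
  refine Primrec.option_casesOn Primrec.fst Primrec.snd ?_
  have hT : Primrec fun x : (Option (ℕ × ℕ) × ListTape) × (ℕ × ℕ) => x.1.2 :=
    Primrec.snd.comp Primrec.fst
  exact moveHead_primrec.comp (Primrec.snd.comp Primrec.snd)
    ((Primrec.fst.comp hT).pair (Primrec.list_cons.comp (Primrec.fst.comp Primrec.snd)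
      (Primrec.list_tail.comp (Primrec.snd.comp hT))))

end ListTape

namespace ListConfig

/-- The `i`-th tape. -/
def tape (s : ListConfig) (i : ℕ) : ListTape := s.2.getD i ([], [])

/-- The configuration described by lists. -/
def toConfig (M : MultitapeTM) (s : ListConfig) : Config M where
  state := s.1
  tapes i := (s.tape i).toTape

/-- The instruction that applies. -/
def instr? (M : MultitapeTM) (s : ListConfig) : Option TMInstr :=
  M.2.find? fun I => decide (I.1 = (s.1, (List.range (M.1 + 1)).map fun i => (s.tape i).2.headI))

/-- One step. -/
def step (M : MultitapeTM) (s : ListConfig) : Option ListConfig :=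
  (instr? M s).map fun I =>
    (I.2.1, (List.range (M.1 + 1)).map fun i => ListTape.actOn I.2.2[i]? (s.tape i))

/-- The initial configuration. -/
def init (w : List Bool) : ListConfig := (0, [([], w.map fun b => cond b 2 1)])

/-- The configuration after `t` steps. -/
def configAt (M : MultitapeTM) (w : List Bool) (t : ℕ) : ListConfig :=
  (fun s => (step M s).getD s)^[t] (init w)

theorem instr?_toConfig (M : MultitapeTM) (s : ListConfig) :
    M.instr? (toConfig M s) = instr? M s := by
  have : (List.ofFn fun i => ((toConfig M s).tapes i).head) =
      (List.range (M.1 + 1)).map fun i => (s.tape i).2.headI := by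
    rw [List.ofFn_eq_map, ← List.map_coe_finRange_eq_range, List.map_map]
    exact List.map_congr_left fun i _ => Tape.mk₂_head _ _
  unfold MultitapeTM.instr? instr?
  rw [this]
  rfl

theorem step_toConfig (M : MultitapeTM) (s : ListConfig) :
    M.step (toConfig M s) = (step M s).map (toConfig M) := by
  unfold MultitapeTM.step step
  rw [instr?_toConfig, Option.map_map]
  congr 1
  funext I
  refine congrArg (Config.mk I.2.1) (funext fun i => ?_)
  have : i.1 < M.1 + 1 := i.2
  simp only [tape, List.getD_eq_getElem?_getD, List.getElem?_map, List.getElem?_range this]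
  exact (ListTape.toTape_actOn _ _).symm

theorem toConfig_init (M : MultitapeTM) (w : List Bool) : toConfig M (init w) = M.init w := by
  refine congrArg (Config.mk 0) (funext fun i => ?_)
  by_cases hi : (i : ℕ) = 0
  · rw [if_pos hi, hi]; rfl
  · obtain ⟨j, hj⟩ := Nat.exists_eq_succ_of_ne_zero hi
    rw [if_neg hi, hj]; rfl

theorem toConfig_configAt (M : MultitapeTM) (w : List Bool) (t : ℕ) :
    toConfig M (configAt M w t) = M.configAt w t := by
  induction t with
  | zero => exact toConfig_init M w
  | succ t ih =>
    rw [configAt, MultitapeTM.configAt, Function.iterate_succ_apply', Function.iterate_succ_apply',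
      ← configAt, ← MultitapeTM.configAt, ← ih, step_toConfig]
    cases step M (configAt M w t) <;> rfl

theorem acceptsWithin_iff (M : MultitapeTM) (w : List Bool) (t : ℕ) :
    M.AcceptsWithin w t ↔
      instr? M (configAt M w t) = none ∧ (configAt M w t).1 = 1 := by
  rw [AcceptsWithin, HaltsWithin, ← toConfig_configAt, step_toConfig, Option.map_eq_none_iff, step,
    Option.map_eq_none_iff]
  rfl

theorem tape_primrec : Primrec₂ tape :=
  (Primrec.list_getD _).comp (Primrec.snd.comp Primrec.fst) Primrec.snd

theorem instr?_primrec : Primrec₂ instr? := by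
  refine Primrec.list_find? (Primrec.snd.comp Primrec.fst) ?_
  refine (Primrec.eq.comp (Primrec.fst.comp Primrec.snd) ?_).decide
  refine (Primrec.fst.comp (Primrec.snd.comp Primrec.fst)).pair ?_
  refine Primrec.list_map (Primrec.list_range.comp (Primrec.succ.comp
    (Primrec.fst.comp (Primrec.fst.comp Primrec.fst)))) ?_
  exact Primrec.list_headI.comp (Primrec.snd.comp (tape_primrec.comp
    (Primrec.snd.comp (Primrec.fst.comp Primrec.fst)) Primrec.snd))

theorem step_primrec : Primrec₂ step := by
  refine Primrec.option_map instr?_primrec ?_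
  refine (Primrec.fst.comp (Primrec.snd.comp Primrec.snd)).pair ?_
  refine Primrec.list_map (Primrec.list_range.comp (Primrec.succ.comp
    (Primrec.fst.comp (Primrec.fst.comp Primrec.fst)))) ?_
  exact ListTape.actOn_primrec.comp
    (Primrec.list_getElem?.comp (Primrec.snd.comp (Primrec.snd.comp (Primrec.snd.comp
      Primrec.fst))) Primrec.snd)
    (tape_primrec.comp (Primrec.snd.comp (Primrec.fst.comp Primrec.fst)) Primrec.snd)

theorem init_primrec : Primrec init := by
  refine (Primrec.const 0).pair (Primrec.list_cons.comp ((Primrec.const []).pair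
    (Primrec.list_map Primrec.id ?_)) (Primrec.const []))
  exact (Primrec.cond Primrec.snd (Primrec.const 2) (Primrec.const 1))

theorem configAt_primrec :
    Primrec fun x : MultitapeTM × List Bool × ℕ => configAt x.1 x.2.1 x.2.2 := by
  refine Primrec.nat_iterate (Primrec.snd.comp Primrec.snd)
    (init_primrec.comp (Primrec.fst.comp Primrec.snd)) ?_
  exact Primrec.option_getD.comp (step_primrec.comp (Primrec.fst.comp Primrec.fst) Primrec.snd)
    Primrec.snd

end ListConfig

theorem acceptsWithin_primrec :
    PrimrecPred fun x : MultitapeTM × List Bool × ℕ => x.1.AcceptsWithin x.2.1 x.2.2 := by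
  refine PrimrecPred.of_eq (PrimrecPred.and (Primrec.eq.comp (ListConfig.instr?_primrec.comp
    Primrec.fst ListConfig.configAt_primrec) (Primrec.const none)) (Primrec.eq.comp
    (Primrec.fst.comp ListConfig.configAt_primrec) (Primrec.const 1))) fun x => ?_
  exact (ListConfig.acceptsWithin_iff _ _ _).symm

end MultitapeTM

/-! ### Almost inclusion is a `Σ⁰₂` preorder -/

theorem mem_quadLang_primrec : PrimrecPred fun x : ℕ × List Bool => x.2 ∈ quadLang x.1 := by
  have hM : Primrec fun x : ℕ × List Bool => Denumerable.ofNat (MultitapeTM × ℕ) x.1 :=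
    (Primrec.ofNat _).comp Primrec.fst
  have hn : Primrec fun x : ℕ × List Bool => x.2.length := Primrec.list_length.comp Primrec.snd
  refine (MultitapeTM.acceptsWithin_primrec.comp ((Primrec.fst.comp hM).pair
    (Primrec.snd.pair (Primrec.nat_mul.comp (Primrec.snd.comp hM)
      (Primrec.succ.comp (Primrec.nat_mul.comp hn hn)))))).of_eq fun x => ?_
  rw [quadLang, clockedLanguage, ← sq]
  rfl

/-- The word with a given code. -/
def decodeWord (b : ℕ) : List Bool := (Encodable.decode (α := List Bool) b).getD []

/-- The existential quantifier guesses a strict bound on the lengths of the words in the difference;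
since there are finitely many words below each length, such a bound exists exactly when the
difference is finite. -/
theorem isSigma02_almostSubset :
    IsSigma02 fun e i => AlmostSubset (quadLang e) (quadLang i) := by
  classical
  have hw : Primrec fun x : ℕ × ℕ × ℕ × ℕ => decodeWord x.2.2.2 :=
    Primrec.option_getD.comp (Primrec.decode.comp (Primrec.snd.comp (Primrec.snd.comp Primrec.snd)))
      (Primrec.const [])
  have h₁ : PrimrecPred fun x : ℕ × ℕ × ℕ × ℕ => (decodeWord x.2.2.2).length < x.2.2.1 :=
    Primrec.nat_lt.comp (Primrec.list_length.comp hw)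
      (Primrec.fst.comp (Primrec.snd.comp Primrec.snd))
  have h₂ : PrimrecPred fun x : ℕ × ℕ × ℕ × ℕ => decodeWord x.2.2.2 ∈ quadLang x.1 :=
    PrimrecPred.comp (f := fun x : ℕ × ℕ × ℕ × ℕ => (x.1, decodeWord x.2.2.2))
      mem_quadLang_primrec (Primrec.fst.pair hw)
  have h₃ : PrimrecPred fun x : ℕ × ℕ × ℕ × ℕ => decodeWord x.2.2.2 ∈ quadLang x.2.1 :=
    PrimrecPred.comp (f := fun x : ℕ × ℕ × ℕ × ℕ => (x.2.1, decodeWord x.2.2.2))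
      mem_quadLang_primrec ((Primrec.fst.comp Primrec.snd).pair hw)
  have hp := h₁.or (h₂.not.or h₃)
  refine ⟨_, hp.decide.to_comp, fun e i => ?_⟩
  simp only [decide_eq_true_eq]
  constructor
  · intro h
    obtain ⟨a, ha⟩ := (h.image List.length).bddAbove
    refine ⟨a + 1, fun b => ?_⟩
    by_contra hb
    push Not at hb
    have := ha ⟨_, ⟨hb.2.1, hb.2.2⟩, rfl⟩
    omega
  · rintro ⟨a, ha⟩
    refine (List.finite_length_lt Bool a).subset fun w hw => ?_
    have := ha (Encodable.encode w)
    rw [decodeWord, Encodable.encodek, Option.getD_some] at this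
    rcases this with h | h | h
    · exact h
    · exact absurd hw.1 h
    · exact absurd h hw.2

theorem isPreorder_almostSubset : IsPreorder ℕ fun e i => AlmostSubset (quadLang e) (quadLang i) where
  refl e := by simp [AlmostSubset]
  trans e f g h h' := by
    refine (h.union h').subset fun w hw => ?_
    by_cases hf : w ∈ quadLang f
    · exact Or.inr ⟨hf, hw.2⟩
    · exact Or.inl ⟨hw.1, hf⟩

/-! ### Primitive recursive functions on one-tape machines -/

open Turing in
instance : Fintype PartrecToTM2.K' where
  elems := {.main, .rev, .aux, .stack}
  complete k := by cases k <;> simp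

namespace Turing.PartrecToTM2

theorem trNat_two_mul_add_one (m : ℕ) : trNat (2 * m + 1) = Γ'.bit1 :: trNat m := by
  have : ((2 * m + 1 : ℕ) : Num) = Num.bit1 m := by
    rw [← Num.bit1_of_bit1, two_mul]; push_cast; rfl
  rw [trNat, this, trNat]
  cases (m : Num) <;> rfl

theorem trNat_two_mul {m : ℕ} (hm : m ≠ 0) : trNat (2 * m) = Γ'.bit0 :: trNat m := by
  have : ((2 * m : ℕ) : Num) = Num.bit0 m := by
    rw [← Num.bit0_of_bit0, two_mul]; push_cast; rfl
  rw [trNat, this, trNat]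
  cases h : (m : Num) with
  | zero =>
    have := Num.to_of_nat m
    rw [h] at this
    exact absurd this.symm hm
  | pos p => rfl

/-- All binary digits of 2 ^ j - 1 are ones. A machine that takes binary input thus takes `j` in
unary, a format that the padded machine can write while reading. -/
theorem trNat_two_pow_sub_one (j : ℕ) : trNat (2 ^ j - 1) = List.replicate j Γ'.bit1 := by
  induction j with
  | zero => simp
  | succ j ih =>
    have : 2 ^ (j + 1) - 1 = 2 * (2 ^ j - 1) + 1 := by
      have := Nat.one_le_two_pow (n := j)
      rw [pow_succ]; omega
    rw [this, trNat_two_mul_add_one, ih]; rfl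

end Turing.PartrecToTM2

/-- The number whose binary digits are a leading one, followed by `l`. -/
def bitsNum (l : List Bool) : ℕ := l.foldl (fun m b => cond b (2 * m + 1) (2 * m)) 1

-- The leading one keeps zeros at the front of `l` from being lost. The reversal is there because
-- `trNat` begins with the lowest digit.
open Turing PartrecToTM2 in
theorem trNat_bitsNum (l : List Bool) :
    (trNat (bitsNum l)).reverse = Γ'.bit1 :: l.map fun b => cond b Γ'.bit1 Γ'.bit0 := by
  -- Doubling appends a digit only to a nonzero number.
  have key : ∀ (l : List Bool) (m : ℕ), m ≠ 0 →
      (trNat (l.foldl (fun m b => cond b (2 * m + 1) (2 * m)) m)).reverse =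
        (trNat m).reverse ++ l.map fun b => cond b Γ'.bit1 Γ'.bit0 := by
    intro l
    induction l with
    | nil => simp
    | cons b l ih =>
      intro m hm
      cases b
      · rw [List.foldl_cons, ih _ (by simpa using hm)]
        simp [trNat_two_mul hm]
      · rw [List.foldl_cons, ih _ (by simp)]
        simp [trNat_two_mul_add_one]
  rw [bitsNum, key l 1 one_ne_zero]
  have := trNat_two_pow_sub_one 1
  rw [show 2 ^ 1 - 1 = 1 from rfl] at this
  rw [this]; rfl

theorem bitsNum_primrec : Primrec bitsNum := by
  refine Primrec.list_foldl (h := fun _ x => cond x.2 (2 * x.1 + 1) (2 * x.1))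
    (Primrec.id (α := List Bool)) (Primrec.const 1) ?_
  have hm : Primrec fun x : List Bool × ℕ × Bool => 2 * x.2.1 :=
    Primrec.nat_mul.comp (Primrec.const 2) (Primrec.fst.comp Primrec.snd)
  exact Primrec.cond (Primrec.snd.comp Primrec.snd) (Primrec.succ.comp hm) hm

/-- The greatest `k ≤ m` with `2 ^ k ≤ m + 1`. -/
def log2Succ (m : ℕ) : ℕ := m.findGreatest fun k => 2 ^ k ≤ m + 1

theorem log2Succ_two_pow_sub_one (j : ℕ) : log2Succ (2 ^ j - 1) = j := by
  have h1 : 2 ^ j - 1 + 1 = 2 ^ j := Nat.sub_add_cancel Nat.one_le_two_pow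
  rw [log2Succ, h1, Nat.findGreatest_eq_iff]
  refine ⟨Nat.le_sub_one_of_lt Nat.lt_two_pow_self, fun _ => le_rfl, fun k hk _ => ?_⟩
  exact Nat.not_le.2 (Nat.pow_lt_pow_right one_lt_two hk)

theorem log2Succ_primrec : Primrec log2Succ := by
  refine Primrec.nat_findGreatest Primrec.id ?_
  have hp : Primrec₂ ((· ^ ·) : ℕ → ℕ → ℕ) := Primrec₂.unpaired'.1 Nat.Primrec.pow
  exact Primrec.nat_le.comp (hp.comp (Primrec.const 2) Primrec.snd)
    (Primrec.succ.comp Primrec.fst)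

open Turing PartrecToTM2 in
theorem exists_tm2 {F : ℕ → ℕ} (hF : Primrec F) :
    ∃ c : ToPartrec.Code, ∀ n, PartrecToTM2.halt [F n] ∈
      StateTransition.eval (TM2.step PartrecToTM2.tr) (PartrecToTM2.init c [n]) := by
  have hF' : @Nat.Partrec' 1 fun v => (F v.head : Part ℕ) :=
    Nat.Partrec'.of_prim (hF.comp Primrec.vector_head)
  obtain ⟨c, hc⟩ := ToPartrec.Code.exists_code hF'
  refine ⟨c, fun n => ?_⟩
  rw [PartrecToTM2.tr_eval]
  have := hc (n ::ᵥ List.Vector.nil)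
  have h2 : c.eval [n] = pure [F n] := by
    refine this.trans ?_
    simp
  rw [h2]
  exact Part.mem_map _ (Part.mem_some _)

open Turing in
/-- A primitive recursive `G` is computed by a one-tape machine with a finite support, which takes
`j` in unary and writes `G j` on the tape. -/
theorem exists_tm0 {G : ℕ → List Bool} (hG : Primrec G) :
    ∃ (Γ Λ : Type) (_ : Inhabited Γ) (_ : Fintype Γ) (_ : Inhabited Λ) (N : TM0.Machine Γ Λ)
      (S : Finset Λ) (bot one : Γ) (P : Γ → Prop), TM0.Supports N (S : Set Λ) ∧
      ∀ j, ∃ c ∈ StateTransition.eval (TM0.step N)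
        (TM0.init (bot :: List.replicate j one)),
        ∀ x : ℕ, P (c.Tape.nth ((x + 2 : ℕ) : ℤ)) ↔ (G j)[x]? = some true := by
  obtain ⟨code, hcode⟩ := exists_tm2 (bitsNum_primrec.comp (hG.comp log2Succ_primrec))
  let k₀ := PartrecToTM2.K'.main
  -- `TM2.init` starts in the default state, so this has to be the entry point of `code`.
  let iΛ : Inhabited PartrecToTM2.Λ' :=
    ⟨PartrecToTM2.trNormal code PartrecToTM2.Cont'.halt⟩
  have hs := PartrecToTM2.tr_supports code PartrecToTM2.Cont'.halt
  have hs1 := TM2to1.tr_supports PartrecToTM2.tr hs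
  have hs0 := TM1to0.tr_supports (TM2to1.tr PartrecToTM2.tr) hs1
  let cell (b : Bool) (a : PartrecToTM2.Γ') :
      TM2to1.Γ' PartrecToTM2.K' (fun _ => PartrecToTM2.Γ') :=
    (b, Function.update (fun _ => none) k₀ (some a))
  refine ⟨_, _, TM2to1.Γ'.inhabited, TM2to1.Γ'.fintype, TM1to0.instInhabitedΛ' _, TM1to0.tr (TM2to1.tr PartrecToTM2.tr), _,
    cell true .cons, cell false .bit1, fun a => a.2 k₀ = some .bit1, hs0, fun j => ?_⟩
  have h2 := hcode (2 ^ j - 1)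
  set v := PartrecToTM2.trList [2 ^ j - 1] with hv
  have hinit : PartrecToTM2.init code [2 ^ j - 1] = TM2.init k₀ v := by
    unfold PartrecToTM2.init TM2.init
    congr 1
    funext k
    cases k <;> rfl
  rw [hinit] at h2
  obtain ⟨c1, hc1, hc1'⟩ := StateTransition.tr_eval (TM2to1.tr_respects PartrecToTM2.tr)
    (TM2to1.trCfg_init k₀ v) h2
  obtain ⟨c0, hc0, hc0'⟩ := StateTransition.tr_eval
    (TM1to0.tr_respects (TM2to1.tr PartrecToTM2.tr)) rfl hc1'
  have hv' : TM2to1.trInit k₀ v = cell true .cons :: List.replicate j (cell false .bit1) := by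
    have : v.reverse = PartrecToTM2.Γ'.cons :: List.replicate j .bit1 := by
      simp [hv, PartrecToTM2.trNat_two_pow_sub_one]
    unfold TM2to1.trInit
    rw [this]
    exact congrArg (List.cons (cell true .cons)) (List.map_replicate (f := cell false))
  rw [hv'] at hc0'
  refine ⟨c0, hc0', fun x => ?_⟩
  subst hc0
  obtain ⟨L, hL⟩ := hc1
  have hLm := hL k₀
  -- The head ends on the bottom of the stack: cell 0 holds the separator `cons`, cell 1 the leading
  -- one of `bitsNum`, and cell `x + 2` the `x`-th bit of `G j`.
  simp only [TM1to0.trCfg, Tape.mk'_nth_nat, TM2to1.addBottom_nth_snd]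
  rw [TM2to1.stk_nth_val _ hLm]
  simp only [k₀, PartrecToTM2.K'.elim_main, PartrecToTM2.trList, List.reverse_append,
    List.reverse_cons, List.reverse_nil, List.nil_append, List.singleton_append,
    trNat_bitsNum, log2Succ_two_pow_sub_one, List.getElem?_cons_succ, List.getElem?_map]
  cases (G j)[x]? with
  | none => simp
  | some b => cases b <;> simp

/-! ### Running a one-tape machine while reading padding

A machine with two tapes that reads words `1 ^ j 0 ^ (t + 1)`. It writes the start configuration of
a one-tape machine on input `j` on the second tape and runs it, one step for each of the remaining
`t` letters. If the one-tape machine halts exactly at the end of the word, then a cell of its tape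
at a fixed distance `x + 2` is inspected. -/

namespace Turing.TM0

variable {Γ Λ : Type*} [Inhabited Γ] [Inhabited Λ]

/-- From `c`, the machine halts after exactly `t` steps, in the configuration `d`. -/
def HaltsIn (N : Machine Γ Λ) : ℕ → Cfg Γ Λ → Cfg Γ Λ → Prop
  | 0, c, d => step N c = none ∧ c = d
  | t + 1, c, d => ∃ c', step N c = some c' ∧ HaltsIn N t c' d

theorem exists_haltsIn {N : Machine Γ Λ} {c d : Cfg Γ Λ}
    (h : d ∈ StateTransition.eval (step N) c) : ∃ t, HaltsIn N t c d := by
  obtain ⟨hr, hd⟩ := StateTransition.mem_eval.1 h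
  induction hr using Relation.ReflTransGen.head_induction_on with
  | refl => exact ⟨0, hd, rfl⟩
  | head h' h'' ih =>
    obtain ⟨t, ht⟩ := ih (StateTransition.mem_eval.2 ⟨h'', hd⟩)
    exact ⟨t + 1, _, h', ht⟩

theorem HaltsIn.unique {N : Machine Γ Λ} : ∀ {t t' : ℕ} {c d d' : Cfg Γ Λ},
    HaltsIn N t c d → HaltsIn N t' c d' → t = t' ∧ d = d'
  | 0, 0, _, _, _, ⟨_, h⟩, ⟨_, h'⟩ => ⟨rfl, h.symm.trans h'⟩
  | 0, _ + 1, _, _, _, ⟨h, _⟩, ⟨_, h', _⟩ => by rw [h] at h'; cases h'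
  | _ + 1, 0, _, _, _, ⟨_, h', _⟩, ⟨h, _⟩ => by rw [h] at h'; cases h'
  | _ + 1, _ + 1, _, _, _, ⟨_, h, hh⟩, ⟨_, h', hh'⟩ => by
    rw [h] at h'
    cases h'
    obtain ⟨rfl, rfl⟩ := hh.unique hh'
    exact ⟨rfl, rfl⟩

end Turing.TM0

namespace PaddedTM

open Turing MultitapeTM

/-! #### Machines with two tapes -/

/-- A configuration of a machine with two tapes. -/
def config (P : List TMInstr) (q : ℕ) (T U : Tape ℕ) : Config ((1, P) : MultitapeTM) where
  state := q
  tapes := (![T, U] : Fin 2 → Tape ℕ)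

theorem step_config (P : List TMInstr) (q : ℕ) (T U : Tape ℕ) :
    MultitapeTM.step (1, P) (config P q T U) =
      (P.find? fun I => decide (I.1 = (q, [T.head, U.head]))).map fun I =>
        config P I.2.1 (actOn I.2.2[0]? T) (actOn I.2.2[1]? U) := by
  unfold MultitapeTM.step
  refine congrArg₂ Option.map ?_ ?_
  · funext I
    refine congrArg (Config.mk (M := (1, P)) I.2.1) (funext fun i : Fin 2 => ?_)
    fin_cases i <;> rfl
  · rfl

theorem step_config_of_mem {P : List TMInstr} {q q' s s' : ℕ} {T U : Tape ℕ}
    {u : List (ℕ × ℕ)} (hT : T.head = s) (hU : U.head = s')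
    (h : ((q, [s, s']), (q', u)) ∈ P) (hu : ∀ I ∈ P, I.1 = (q, [s, s']) → I.2 = (q', u)) :
    MultitapeTM.step (1, P) (config P q T U) =
      some (config P q' (actOn u[0]? T) (actOn u[1]? U)) := by
  rw [step_config, hT, hU, List.find?_key_eq_some h hu]
  rfl

theorem step_config_of_notMem {P : List TMInstr} {q s s' : ℕ} {T U : Tape ℕ}
    (hT : T.head = s) (hU : U.head = s') (h : ∀ I ∈ P, I.1 ≠ (q, [s, s'])) :
    MultitapeTM.step (1, P) (config P q T U) = none := by
  rw [step_config, hT, hU, List.find?_key_eq_none h]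
  rfl

theorem actOn_self {T : Tape ℕ} {s d : ℕ} (h : T.head = s) :
    actOn (some (s, d)) T = moveHead d T := by
  subst h; simp [actOn]

/-! #### The instruction table -/

/-- The direction of a movement as a number. -/
def dirCode : Dir → ℕ
  | Dir.left => 1
  | Dir.right => 2

theorem moveHead_dirCode (d : Dir) (T : Tape ℕ) : moveHead (dirCode d) T = T.move d := by
  cases d <;> rfl

variable {Γ Λ : Type} [Inhabited Γ] [Fintype Γ]

open Classical in
/-- The number of a symbol; the blank has number `0`. -/
noncomputable def symCode (a : Γ) : ℕ := if a = default then 0 else Fintype.equivFin Γ a + 1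

theorem symCode_injective : Function.Injective (symCode : Γ → ℕ) := by
  intro a b h
  unfold symCode at h
  split_ifs at h with ha hb hb
  · rw [ha, hb]
  · exact (Fintype.equivFin Γ).injective (Fin.ext (by omega))

/-- `symCode` as a map of pointed types. -/
noncomputable def symMap : PointedMap Γ ℕ := ⟨symCode, by simp [symCode]⟩

open Classical in
/-- The number of a state. -/
noncomputable def stateCode (S : Finset Λ) (q : Λ) : ℕ := 2 * S.toList.idxOf q + 2

theorem stateCode_inj {S : Finset Λ} {q q' : Λ} (hq : q ∈ S)
    (h : stateCode S q = stateCode S q') : q = q' := by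
  classical
  refine (List.idxOf_inj (l := S.toList) (by simpa using hq)).1 ?_
  unfold stateCode at h
  omega

variable [Inhabited Λ]

/-- The instruction for a state and a symbol. -/
noncomputable def simInstr (N : TM0.Machine Γ Λ) (S : Finset Λ) (q : Λ) (a : Γ) : TMInstr :=
  match N q a with
  | some (q', .move d) =>
    ((stateCode S q, [1, symCode a]), (stateCode S q', [(1, 2), (symCode a, dirCode d)]))
  | some (q', .write b) =>
    ((stateCode S q, [1, symCode a]), (stateCode S q', [(1, 2), (symCode b, 0)]))
  | none => ((stateCode S q, [0, symCode a]), (3, [(0, 0), (symCode a, 0)]))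

/-- The part of the table that does not depend on the inspected cell. -/
noncomputable def baseTable (N : TM0.Machine Γ Λ) (S : Finset Λ) (bot one : Γ) : List TMInstr :=
  ((0, [2, 0]), (0, [(2, 2), (symCode one, 1)])) ::
  ((0, [1, 0]), (stateCode S default, [(1, 2), (symCode bot, 0)])) ::
  S.toList.flatMap fun q => (Finset.univ : Finset Γ).toList.map fun a => simInstr N S q a

/-- The table for the inspection of the cell at distance `x + 2`. -/
def checkTable (syms accs : List ℕ) (x : ℕ) : List TMInstr :=
  ((List.range (x + 2)).flatMap fun i => syms.map fun s =>
    ((2 * i + 3, [0, s]), (2 * i + 5, [(0, 0), (s, 2)]))) ++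
  accs.map fun s => ((2 * x + 7, [0, s]), (1, []))

variable (Γ) in
/-- The numbers of all symbols. -/
noncomputable def symList : List ℕ := (Finset.univ : Finset Γ).toList.map symCode

open Classical in
/-- The numbers of the symbols with the property `P`. -/
noncomputable def accList (P : Γ → Prop) : List ℕ :=
  ((Finset.univ : Finset Γ).filter P).toList.map symCode

/-- The whole table. -/
noncomputable def table (N : TM0.Machine Γ Λ) (S : Finset Λ) (bot one : Γ) (P : Γ → Prop) (x : ℕ) :
    List TMInstr :=
  baseTable N S bot one ++ checkTable (symList Γ) (accList P) x

variable {N : TM0.Machine Γ Λ} {S : Finset Λ} {bot one : Γ} {P : Γ → Prop} {x : ℕ}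

theorem mem_table {I : TMInstr} : I ∈ table N S bot one P x ↔
    I = ((0, [2, 0]), (0, [(2, 2), (symCode one, 1)])) ∨
    I = ((0, [1, 0]), (stateCode S default, [(1, 2), (symCode bot, 0)])) ∨
    (∃ q ∈ S, ∃ a, I = simInstr N S q a) ∨
    (∃ i < x + 2, ∃ a : Γ,
      I = ((2 * i + 3, [0, symCode a]), (2 * i + 5, [(0, 0), (symCode a, 2)]))) ∨
    (∃ a : Γ, P a ∧ I = ((2 * x + 7, [0, symCode a]), (1, []))) := by
  simp only [table, baseTable, checkTable, symList, accList, List.mem_append, List.mem_cons,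
    List.mem_flatMap, List.mem_map, Finset.mem_toList, Finset.mem_univ, true_and, List.mem_range,
    Finset.mem_filter, exists_exists_eq_and, exists_exists_and_eq_and, or_assoc, eq_comm (b := I)]

theorem simInstr_key (q : Λ) (a : Γ) : (simInstr N S q a).1 =
    (stateCode S q, [if N q a = none then 0 else 1, symCode a]) := by
  unfold simInstr
  split <;> rename_i h <;> simp [h]

/-- The configuration of the machine when it simulates. -/
noncomputable def simConfig (N : TM0.Machine Γ Λ) (S : Finset Λ) (bot one : Γ) (P : Γ → Prop)
    (x q : ℕ) (T : Tape ℕ) (U : Tape Γ) : Config ((1, table N S bot one P x) : MultitapeTM) :=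
  config (table N S bot one P x) q T (U.map symMap)

theorem map_symMap_head (U : Tape Γ) : (U.map symMap).head = symCode U.head := Tape.map_fst _ _

/-- Simulation states are even and positive, inspection states are odd, so only simulation
instructions could apply. These ask for a padding letter while `N` runs and for the end of the word
once `N` has halted; otherwise the machine is stuck without accepting. -/
theorem step_sim_none {q : Λ} {T : Tape ℕ} {U : Tape Γ} (hq : q ∈ S) {s : ℕ} (hT : T.head = s)
    (h : s ≠ if N q U.head = none then 0 else 1) :
    MultitapeTM.step (1, table N S bot one P x)
      (simConfig N S bot one P x (stateCode S q) T U) = none := by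
  refine step_config_of_notMem hT (map_symMap_head U) fun I hI hk => ?_
  have hpos : stateCode S q ≠ 0 := by unfold stateCode; omega
  rcases mem_table.1 hI with rfl | rfl | ⟨q', hq', a, rfl⟩ | ⟨i, -, a, rfl⟩ | ⟨a, -, rfl⟩
  · simp only [Prod.mk.injEq] at hk; exact hpos hk.1.symm
  · simp only [Prod.mk.injEq] at hk; exact hpos hk.1.symm
  · rw [simInstr_key] at hk
    simp only [Prod.mk.injEq, List.cons.injEq, and_true] at hk
    obtain rfl := stateCode_inj hq' hk.1
    obtain rfl := symCode_injective hk.2.2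
    exact h hk.2.1.symm
  · simp only [Prod.mk.injEq] at hk; unfold stateCode at hk; omega
  · simp only [Prod.mk.injEq] at hk; unfold stateCode at hk; omega

theorem step_sim {q : Λ} {T : Tape ℕ} {U : Tape Γ} (hq : q ∈ S)
    (hT : T.head = if N q U.head = none then 0 else 1) :
    MultitapeTM.step (1, table N S bot one P x)
      (simConfig N S bot one P x (stateCode S q) T U) =
        some (config (table N S bot one P x) (simInstr N S q U.head).2.1
          (actOn (simInstr N S q U.head).2.2[0]? T)
          (actOn (simInstr N S q U.head).2.2[1]? (U.map symMap))) := by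
  refine step_config_of_mem hT (map_symMap_head U)
    (mem_table.2 (Or.inr (Or.inr (Or.inl ⟨q, hq, U.head, ?_⟩)))) fun I hI hk => ?_
  · exact Prod.ext (simInstr_key _ _).symm rfl
  have hpos : stateCode S q ≠ 0 := by unfold stateCode; omega
  rcases mem_table.1 hI with rfl | rfl | ⟨q', hq', a, rfl⟩ | ⟨i, -, a, rfl⟩ | ⟨a, -, rfl⟩
  · simp only [Prod.mk.injEq] at hk; exact absurd hk.1.symm hpos
  · simp only [Prod.mk.injEq] at hk; exact absurd hk.1.symm hpos
  · rw [simInstr_key] at hk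
    simp only [Prod.mk.injEq, List.cons.injEq, and_true] at hk
    obtain rfl := stateCode_inj hq' hk.1
    obtain rfl := symCode_injective hk.2.2
    rfl
  · simp only [Prod.mk.injEq] at hk; unfold stateCode at hk; omega
  · simp only [Prod.mk.injEq] at hk; unfold stateCode at hk; omega

theorem step_sim_running {q : Λ} {T : Tape ℕ} {U : Tape Γ} {c : TM0.Cfg Γ Λ} (hq : q ∈ S)
    (hT : T.head = 1) (h : TM0.step N ⟨q, U⟩ = some c) :
    MultitapeTM.step (1, table N S bot one P x)
      (simConfig N S bot one P x (stateCode S q) T U) =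
        some (simConfig N S bot one P x (stateCode S c.q) (T.move Dir.right) c.Tape) := by
  obtain ⟨⟨q', s⟩, hN, rfl⟩ := Option.map_eq_some_iff.1 h
  rw [step_sim hq (by rw [hT, if_neg]; simp [hN])]
  have h2 : actOn (some (1, 2)) T = T.move Dir.right := actOn_self hT
  cases s with
  | move d =>
    have : simInstr N S q U.head = ((stateCode S q, [1, symCode U.head]),
        (stateCode S q', [(1, 2), (symCode U.head, dirCode d)])) := by
      unfold simInstr; rw [hN]
    rw [this]
    have h1 : actOn (some (symCode U.head, dirCode d)) (U.map symMap) =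
        (U.move d).map symMap := by
      rw [actOn_self (map_symMap_head U), moveHead_dirCode, Tape.map_move]
    simp only [simConfig, List.getElem?_cons_zero, List.getElem?_cons_succ, h1, h2]
  | write b =>
    have : simInstr N S q U.head = ((stateCode S q, [1, symCode U.head]),
        (stateCode S q', [(1, 2), (symCode b, 0)])) := by
      unfold simInstr; rw [hN]
    rw [this]
    have h1 : actOn (some (symCode b, 0)) (U.map symMap) = (U.write b).map symMap := by
      rw [Tape.map_write]; rfl
    simp only [simConfig, List.getElem?_cons_zero, List.getElem?_cons_succ, h1, h2]

theorem step_sim_halted {q : Λ} {T : Tape ℕ} {U : Tape Γ} (hq : q ∈ S)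
    (hT : T.head = 0) (h : TM0.step N ⟨q, U⟩ = none) :
    MultitapeTM.step (1, table N S bot one P x)
      (simConfig N S bot one P x (stateCode S q) T U) =
        some (simConfig N S bot one P x 3 T U) := by
  have hN : N q U.head = none := Option.map_eq_none_iff.1 h
  rw [step_sim hq (by rw [hT, if_pos hN])]
  have : simInstr N S q U.head = ((stateCode S q, [0, symCode U.head]),
      (3, [(0, 0), (symCode U.head, 0)])) := by
    unfold simInstr; rw [hN]
  rw [this]
  have h1 : actOn (some (symCode U.head, 0)) (U.map symMap) = U.map symMap :=
    actOn_self (map_symMap_head U)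
  have h2 : actOn (some (0, 0)) T = T := actOn_self hT
  simp only [simConfig, List.getElem?_cons_zero, List.getElem?_cons_succ, h1, h2]

theorem step_check {i : ℕ} (hi : i < x + 2) {T : Tape ℕ} {U : Tape Γ} (hT : T.head = 0) :
    MultitapeTM.step (1, table N S bot one P x) (simConfig N S bot one P x (2 * i + 3) T U) =
      some (simConfig N S bot one P x (2 * i + 5) T (U.move Dir.right)) := by
  unfold simConfig
  rw [step_config_of_mem (q' := 2 * i + 5) (u := [(0, 0), (symCode U.head, 2)]) hT
    (map_symMap_head U)]
  · have h1 : actOn (some (symCode U.head, 2)) (U.map symMap) = (U.move Dir.right).map symMap := by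
      rw [actOn_self (map_symMap_head U), Tape.map_move]; rfl
    have h2 : actOn (some (0, 0)) T = T := actOn_self hT
    simp only [List.getElem?_cons_zero, List.getElem?_cons_succ, h1, h2]
  · exact mem_table.2 (Or.inr (Or.inr (Or.inr (Or.inl ⟨i, hi, _, rfl⟩))))
  · intro I hI hk
    rcases mem_table.1 hI with rfl | rfl | ⟨q', hq', a, rfl⟩ | ⟨j, hj, a, rfl⟩ | ⟨a, -, rfl⟩
    · simp only [Prod.mk.injEq] at hk; omega
    · simp only [Prod.mk.injEq] at hk; omega
    · rw [simInstr_key] at hk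
      simp only [Prod.mk.injEq] at hk; unfold stateCode at hk; omega
    · simp only [Prod.mk.injEq, List.cons.injEq, and_true, true_and] at hk
      obtain rfl : j = i := by omega
      rw [hk.2]
    · simp only [Prod.mk.injEq] at hk; omega

theorem step_check_end_pos {T : Tape ℕ} {U : Tape Γ} (hT : T.head = 0) (hP : P U.head) :
    MultitapeTM.step (1, table N S bot one P x) (simConfig N S bot one P x (2 * x + 7) T U) =
      some (simConfig N S bot one P x 1 T U) := by
  unfold simConfig
  rw [step_config_of_mem (q' := 1) (u := []) hT (map_symMap_head U)]
  · rfl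
  · exact mem_table.2 (Or.inr (Or.inr (Or.inr (Or.inr ⟨_, hP, rfl⟩))))
  · intro I hI hk
    rcases mem_table.1 hI with rfl | rfl | ⟨q', hq', a, rfl⟩ | ⟨j, hj, a, rfl⟩ | ⟨a, -, rfl⟩
    · simp only [Prod.mk.injEq] at hk; omega
    · simp only [Prod.mk.injEq] at hk; omega
    · rw [simInstr_key] at hk
      simp only [Prod.mk.injEq] at hk; unfold stateCode at hk; omega
    · simp only [Prod.mk.injEq] at hk; omega
    · rfl

theorem step_check_end_neg {T : Tape ℕ} {U : Tape Γ} (hT : T.head = 0) (hP : ¬ P U.head) :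
    MultitapeTM.step (1, table N S bot one P x) (simConfig N S bot one P x (2 * x + 7) T U) =
      none := by
  refine step_config_of_notMem hT (map_symMap_head U) fun I hI hk => ?_
  rcases mem_table.1 hI with rfl | rfl | ⟨q', hq', a, rfl⟩ | ⟨i, hi, a, rfl⟩ | ⟨a, ha, rfl⟩
  · simp only [Prod.mk.injEq] at hk; omega
  · simp only [Prod.mk.injEq] at hk; omega
  · rw [simInstr_key] at hk
    simp only [Prod.mk.injEq] at hk; unfold stateCode at hk; omega
  · simp only [Prod.mk.injEq] at hk; omega
  · simp only [Prod.mk.injEq, List.cons.injEq, and_true, true_and] at hk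
    exact hP (symCode_injective hk ▸ ha)

theorem step_accept {T : Tape ℕ} {U : Tape Γ} :
    MultitapeTM.step (1, table N S bot one P x) (simConfig N S bot one P x 1 T U) = none := by
  refine step_config_of_notMem rfl rfl fun I hI hk => ?_
  rcases mem_table.1 hI with rfl | rfl | ⟨q', hq', a, rfl⟩ | ⟨i, hi, a, rfl⟩ | ⟨a, ha, rfl⟩
  · simp only [Prod.mk.injEq] at hk; omega
  · simp only [Prod.mk.injEq] at hk; omega
  · rw [simInstr_key] at hk
    simp only [Prod.mk.injEq] at hk; unfold stateCode at hk; omega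
  · simp only [Prod.mk.injEq] at hk; omega
  · simp only [Prod.mk.injEq] at hk; omega

theorem step_start_true {T U : Tape ℕ} (hT : T.head = 2) (hU : U.head = 0) :
    MultitapeTM.step (1, table N S bot one P x) (config (table N S bot one P x) 0 T U) =
      some (config (table N S bot one P x) 0 (T.move Dir.right)
        ((U.write (symCode one)).move Dir.left)) := by
  rw [step_config_of_mem (q' := 0) (u := [(2, 2), (symCode one, 1)]) hT hU]
  · have h2 : actOn (some (2, 2)) T = T.move Dir.right := actOn_self hT
    simp only [List.getElem?_cons_zero, List.getElem?_cons_succ, h2]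
    rfl
  · exact mem_table.2 (Or.inl rfl)
  · intro I hI hk
    rcases mem_table.1 hI with rfl | rfl | ⟨q', hq', a, rfl⟩ | ⟨i, hi, a, rfl⟩ | ⟨a, ha, rfl⟩
    · rfl
    · simp at hk
    · rw [simInstr_key] at hk
      simp only [Prod.mk.injEq] at hk; unfold stateCode at hk; omega
    · simp only [Prod.mk.injEq] at hk; omega
    · simp only [Prod.mk.injEq] at hk; omega

theorem step_start_false {T U : Tape ℕ} (hT : T.head = 1) (hU : U.head = 0) :
    MultitapeTM.step (1, table N S bot one P x) (config (table N S bot one P x) 0 T U) =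
      some (config (table N S bot one P x) (stateCode S default) (T.move Dir.right)
        (U.write (symCode bot))) := by
  rw [step_config_of_mem (q' := stateCode S default) (u := [(1, 2), (symCode bot, 0)]) hT hU]
  · have h2 : actOn (some (1, 2)) T = T.move Dir.right := actOn_self hT
    simp only [List.getElem?_cons_zero, List.getElem?_cons_succ, h2]
    rfl
  · exact mem_table.2 (Or.inr (Or.inl rfl))
  · intro I hI hk
    rcases mem_table.1 hI with rfl | rfl | ⟨q', hq', a, rfl⟩ | ⟨i, hi, a, rfl⟩ | ⟨a, ha, rfl⟩
    · simp at hk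
    · rfl
    · rw [simInstr_key] at hk
      simp only [Prod.mk.injEq] at hk; unfold stateCode at hk; omega
    · simp only [Prod.mk.injEq] at hk; omega
    · simp only [Prod.mk.injEq] at hk; omega

theorem step_start_end {T U : Tape ℕ} (hT : T.head = 0) :
    MultitapeTM.step (1, table N S bot one P x) (config (table N S bot one P x) 0 T U) = none := by
  refine step_config_of_notMem hT rfl fun I hI hk => ?_
  rcases mem_table.1 hI with rfl | rfl | ⟨q', hq', a, rfl⟩ | ⟨i, hi, a, rfl⟩ | ⟨a, ha, rfl⟩
  · simp at hk
  · simp at hk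
  · rw [simInstr_key] at hk
    simp only [Prod.mk.injEq] at hk; unfold stateCode at hk; omega
  · simp only [Prod.mk.injEq] at hk; omega
  · simp only [Prod.mk.injEq] at hk; omega

/-! #### The accepted words -/

/-- The state `2 * i + 3` records that `i` cells have been passed, and `k` cells remain up to the
inspected one. -/
theorem accepts_check {T : Tape ℕ} (hT : T.head = 0) {k : ℕ} :
    ∀ {i : ℕ} {U : Tape Γ} (m : ℕ), i + k = x + 2 →
    (AcceptsFrom (1, table N S bot one P x) (m + k + 1)
      (simConfig N S bot one P x (2 * i + 3) T U) ↔ P (U.nth (k : ℤ))) := by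
  induction k with
  | zero =>
    intro i U m hi
    rw [show 2 * i + 3 = 2 * x + 7 by omega]
    by_cases hP : P U.head
    · rw [acceptsFrom_succ (step_check_end_pos hT hP), acceptsFrom_of_halted step_accept]
      exact iff_of_true rfl hP
    · rw [acceptsFrom_of_halted (step_check_end_neg hT hP)]
      refine iff_of_false ?_ hP
      simp [simConfig, config]
  | succ k ih =>
    intro i U m hi
    rw [acceptsFrom_succ (step_check (by omega) hT)]
    refine (ih (i := i + 1) m (by omega)).trans ?_
    rw [Tape.move_right_nth]
    push_cast; rfl

/-- Each letter `false` pays for one step of `N`, so the inspection is reached only if `N` halts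
exactly when the word ends. The `x + 4` further steps are one to leave the simulation, `x + 2` moves
and one to accept. -/
theorem accepts_sim (hS : TM0.Supports N (S : Set Λ)) (r : List ℕ) :
    ∀ (l : List ℕ) (c : TM0.Cfg Γ Λ) (m : ℕ), (∀ a ∈ r, a = 1 ∨ a = 2) → c.q ∈ S →
    (AcceptsFrom (1, table N S bot one P x) (m + (x + 4) + r.length)
      (simConfig N S bot one P x (stateCode S c.q) (Tape.mk₂ l r) c.Tape) ↔
      ∃ t d, r = List.replicate t 1 ∧ TM0.HaltsIn N t c d ∧
        P (d.Tape.nth ((x + 2 : ℕ) : ℤ))) := by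
  have hne : ∀ (T : Tape ℕ) (c : TM0.Cfg Γ Λ),
      (simConfig N S bot one P x (stateCode S c.q) T c.Tape).state ≠ 1 := by
    intro T c
    simp only [simConfig, config, stateCode]
    omega
  induction r with
  | nil =>
    intro l c m _ hq
    have hT : (Tape.mk₂ l ([] : List ℕ)).head = 0 := by simp [Tape.mk₂_head]
    cases h : TM0.step N c with
    | none =>
      rw [show m + (x + 4) + ([] : List ℕ).length = m + (x + 2) + 1 + 1 by simp; omega,
        acceptsFrom_succ (step_sim_halted hq hT h)]
      refine (accepts_check (i := 0) hT m (by omega)).trans ⟨fun hP => ⟨0, c, rfl, ⟨h, rfl⟩, hP⟩, ?_⟩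
      rintro ⟨t, d, ht, hd, hP⟩
      cases t with
      | zero => obtain ⟨-, rfl⟩ := hd; exact hP
      | succ t => simp [List.replicate_succ] at ht
    | some c' =>
      have hN : N c.q c.Tape.head ≠ none := by
        intro h'
        have : TM0.step N c = none := Option.map_eq_none_iff.2 h'
        rw [this] at h; cases h
      rw [acceptsFrom_of_halted (step_sim_none hq hT (by rw [if_neg hN]; omega))]
      refine iff_of_false (hne _ _) ?_
      rintro ⟨t, d, ht, hd, hP⟩
      cases t with
      | zero => rw [hd.1] at h; cases h
      | succ t => simp [List.replicate_succ] at ht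
  | cons a r ih =>
    intro l c m hr hq
    have hT : (Tape.mk₂ l (a :: r)).head = a := by simp [Tape.mk₂_head]
    by_cases ha : a = 1
    · subst ha
      cases h : TM0.step N c with
      | none =>
        have hN : N c.q c.Tape.head = none := Option.map_eq_none_iff.1 h
        rw [acceptsFrom_of_halted (step_sim_none hq hT (by rw [if_pos hN]; omega))]
        refine iff_of_false (hne _ _) ?_
        rintro ⟨t, d, ht, hd, hP⟩
        cases t with
        | zero => simp at ht
        | succ t => obtain ⟨c', hc', -⟩ := hd; rw [h] at hc'; cases hc'
      | some c' =>
        have hq' : c'.q ∈ S := TM0.step_supports N hS h hq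
        rw [List.length_cons, ← Nat.add_assoc, acceptsFrom_succ (step_sim_running hq hT h),
          Tape.mk₂_move_right]
        refine (ih _ c' m (fun b hb => hr b (List.mem_cons_of_mem _ hb)) hq').trans ?_
        constructor
        · rintro ⟨t, d, ht, hd, hP⟩
          exact ⟨t + 1, d, by rw [ht]; rfl, ⟨c', h, hd⟩, hP⟩
        · rintro ⟨t, d, ht, hd, hP⟩
          cases t with
          | zero => simp at ht
          | succ t =>
            obtain ⟨c'', hc', hd⟩ := hd
            rw [h] at hc'
            cases hc'
            exact ⟨t, d, (List.cons.inj ht).2, hd, hP⟩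
    · have h2 : a = 2 := (hr a List.mem_cons_self).resolve_left ha
      rw [acceptsFrom_of_halted (step_sim_none hq hT (by split_ifs <;> omega))]
      refine iff_of_false (hne _ _) ?_
      rintro ⟨t, d, ht, hd, hP⟩
      cases t with
      | zero => simp at ht
      | succ t => exact ha (List.cons.inj ht).1

/-- Each `true` adds a symbol `one` at the left end of the second tape, and the first `false` puts
`bot` in front of them, which completes the start configuration. That letter pays for no step of
`N`, whence `t + 1`. -/
theorem accepts_start (hS : TM0.Supports N (S : Set Λ)) (r : List ℕ) :
    ∀ (l : List ℕ) (j m : ℕ), (∀ a ∈ r, a = 1 ∨ a = 2) →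
    (AcceptsFrom (1, table N S bot one P x) (m + (x + 4) + r.length)
      (config (table N S bot one P x) 0 (Tape.mk₂ l r)
        (Tape.mk₂ [] (0 :: List.replicate j (symCode one)))) ↔
      ∃ i t d, r = List.replicate i 2 ++ List.replicate (t + 1) 1 ∧
        TM0.HaltsIn N t (TM0.init (bot :: List.replicate (i + j) one)) d ∧
        P (d.Tape.nth ((x + 2 : ℕ) : ℤ))) := by
  induction r with
  | nil =>
    intro l j m _
    rw [acceptsFrom_of_halted (step_start_end (by simp [Tape.mk₂_head]))]
    refine iff_of_false (by simp [config]) ?_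
    rintro ⟨i, t, d, h, -⟩
    simp [List.replicate_succ] at h
  | cons a r ih =>
    intro l j m hr
    have hT : (Tape.mk₂ l (a :: r)).head = a := by simp [Tape.mk₂_head]
    have hU : (Tape.mk₂ [] (0 :: List.replicate j (symCode one))).head = 0 := by
      simp [Tape.mk₂_head]
    rw [List.length_cons, ← Nat.add_assoc]
    rcases hr a List.mem_cons_self with rfl | rfl
    · rw [acceptsFrom_succ (step_start_false hT hU), Tape.mk₂_move_right, Tape.mk₂_write]
      have e : Tape.mk₂ [] (symCode bot :: (0 :: List.replicate j (symCode one)).tail) =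
          (Tape.mk₁ (bot :: List.replicate j one)).map symMap := by
        rw [Tape.map_mk₁, List.map_cons, List.map_replicate]; rfl
      rw [e]
      refine (accepts_sim hS r _ (TM0.init (bot :: List.replicate j one)) m
        (fun b hb => hr b (List.mem_cons_of_mem _ hb)) hS.1).trans ?_
      constructor
      · rintro ⟨t, d, ht, hd, hP⟩
        exact ⟨0, t, d, by rw [ht]; rfl, by rwa [Nat.zero_add], hP⟩
      · rintro ⟨i, t, d, ht, hd, hP⟩
        cases i with
        | zero =>
          rw [Nat.zero_add] at hd
          exact ⟨t, d, (List.cons.inj ht).2, hd, hP⟩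
        | succ i => simp [List.replicate_succ] at ht
    · rw [acceptsFrom_succ (step_start_true hT hU), Tape.mk₂_move_right, Tape.mk₂_write,
        Tape.mk₂_move_left]
      refine (ih _ (j + 1) m fun b hb => hr b (List.mem_cons_of_mem _ hb)).trans ?_
      constructor
      · rintro ⟨i, t, d, ht, hd, hP⟩
        exact ⟨i + 1, t, d, by rw [ht]; rfl,
          by rwa [Nat.add_right_comm], hP⟩
      · rintro ⟨i, t, d, ht, hd, hP⟩
        cases i with
        | zero => simp [List.replicate_succ] at ht
        | succ i =>
          exact ⟨i, t, d, (List.cons.inj ht).2, by rwa [Nat.add_right_comm] at hd, hP⟩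

theorem mem_clockedLanguage (hS : TM0.Supports N (S : Set Λ)) (w : List Bool) :
    w ∈ clockedLanguage (fun n => n ^ 2) (1, table N S bot one P x) (x + 4) ↔
      ∃ i t d, w = List.replicate i true ++ List.replicate (t + 1) false ∧
        TM0.HaltsIn N t (TM0.init (bot :: List.replicate i one)) d ∧
        P (d.Tape.nth ((x + 2 : ℕ) : ℤ)) := by
  let f : Bool → ℕ := fun b => cond b 2 1
  have hf : Function.Injective f := by intro a b; cases a <;> cases b <;> simp [f]
  have hinit : MultitapeTM.init (1, table N S bot one P x) w =
      config (table N S bot one P x) 0 (Tape.mk₂ [] (w.map f))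
        (Tape.mk₂ [] (0 :: List.replicate 0 (symCode one))) := by
    refine congrArg (Config.mk 0) (funext fun i : Fin 2 => ?_)
    fin_cases i
    · rfl
    · exact (Tape.mk₂_right_default _).symm
  -- The machine needs at most |w| + x + 4 steps, and the clock constant `x + 4` leaves room for
  -- them.
  obtain ⟨m, hm⟩ : ∃ m, (x + 4) * (w.length ^ 2 + 1) = m + (x + 4) + (w.map f).length := by
    have : w.length ≤ (x + 4) * w.length ^ 2 := by
      nlinarith [Nat.le_self_pow two_ne_zero w.length]
    refine ⟨(x + 4) * w.length ^ 2 - w.length, ?_⟩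
    rw [List.length_map, Nat.mul_add]
    omega
  rw [clockedLanguage, Set.mem_ofPred_eq, acceptsWithin_iff, hinit, hm,
    accepts_start hS (w.map f) [] 0 m fun a ha => ?_]
  · refine exists_congr fun i => exists_congr fun t => exists_congr fun d => and_congr ?_ Iff.rfl
    rw [← (List.map_injective_iff.2 hf).eq_iff, List.map_append, List.map_replicate,
      List.map_replicate]
    rfl
  · obtain ⟨b, -, rfl⟩ := List.mem_map.1 ha
    cases b <;> simp [f]

/-- This is the only part of the table that varies with `x`; the rest, and the noncomputable
numbering of symbols and states, enter as constants. -/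
theorem checkTable_primrec (syms accs : List ℕ) : Primrec (checkTable syms accs) := by
  have h2 : Primrec fun p : ℕ × ℕ => 2 * p.1 := Primrec.nat_mul.comp (Primrec.const 2) Primrec.fst
  have hl : Primrec fun s : ℕ => [0, s] :=
    Primrec.list_cons.comp (Primrec.const 0) (Primrec.list_cons.comp Primrec.id (Primrec.const []))
  have hu : Primrec fun s : ℕ => [(0, 0), (s, 2)] :=
    Primrec.list_cons.comp (Primrec.const (0, 0)) (Primrec.list_cons.comp
      (Primrec.id.pair (Primrec.const 2)) (Primrec.const []))
  have hI : Primrec fun p : ℕ × ℕ =>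
      (((2 * p.1 + 3, [0, p.2]), (2 * p.1 + 5, [(0, 0), (p.2, 2)])) : TMInstr) :=
    ((Primrec.nat_add.comp h2 (Primrec.const 3)).pair (hl.comp Primrec.snd)).pair
      ((Primrec.nat_add.comp h2 (Primrec.const 5)).pair (hu.comp Primrec.snd))
  have hJ : Primrec fun p : ℕ × ℕ => (((2 * p.1 + 7, [0, p.2]), (1, [])) : TMInstr) :=
    ((Primrec.nat_add.comp h2 (Primrec.const 7)).pair (hl.comp Primrec.snd)).pair
      (Primrec.const (1, []))
  have hblock : Primrec fun i : ℕ => syms.map fun s =>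
      (((2 * i + 3, [0, s]), (2 * i + 5, [(0, 0), (s, 2)])) : TMInstr) :=
    Primrec.list_map (Primrec.const syms) hI.to₂
  refine Primrec.list_append.comp (Primrec.list_flatMap (Primrec.list_range.comp
    (Primrec.nat_add.comp Primrec.id (Primrec.const 2))) (hblock.comp Primrec.snd).to₂) ?_
  exact Primrec.list_map (Primrec.const accs) hJ.to₂

end PaddedTM

open Turing in
/-- The languages `{word i | the x-th bit of G i is one}` are quadratic-time computable, with
indices that are computable in `x`. -/
theorem exists_quadLang_eq_image {G : ℕ → List Bool} (hG : Primrec G) :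
    ∃ (g : ℕ → ℕ) (word : ℕ → List Bool), Computable g ∧ Function.Injective word ∧
      ∀ x, quadLang (g x) = word '' {i | (G i)[x]? = some true} := by
  obtain ⟨Γ, Λ, _, _, _, N, S, bot, one, P, hS, h⟩ := exists_tm0 hG
  choose c hc hP using h
  choose t ht using fun j => TM0.exists_haltsIn (hc j)
  refine ⟨fun x => Encodable.encode (((1, PaddedTM.table N S bot one P x), x + 4) :
    MultitapeTM × ℕ), fun j => List.replicate j true ++ List.replicate (t j + 1) false,
    ?_, ?_, fun x => ?_⟩
  · refine (Primrec.encode.comp (Primrec.pair (Primrec.pair (Primrec.const 1) ?_)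
      (Primrec.nat_add.comp Primrec.id (Primrec.const 4)))).to_comp
    exact Primrec.list_append.comp (Primrec.const _) (PaddedTM.checkTable_primrec _ _)
  · intro i j hij
    simpa [List.count_replicate] using congrArg (List.count true) hij
  · ext w
    rw [quadLang, Denumerable.ofNat_encode, PaddedTM.mem_clockedLanguage hS]
    constructor
    · rintro ⟨i, t', d, rfl, hd, hPd⟩
      -- The running time is determined by `i`, so no other amount of padding is accepted.
      obtain ⟨rfl, rfl⟩ := hd.unique (ht i)
      exact ⟨i, (hP i x).1 hPd, rfl⟩
    · rintro ⟨i, hi, rfl⟩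
      exact ⟨i, t i, c i, rfl, ht i, (hP i x).2 hi⟩

/-! ### Hardness -/

/-- The universal variable is made to code a pair of an instance and a step bound: the new predicate
says that the program for the old one does not return `false` within the bound. A false instance is
still exposed by some bound. -/
theorem IsSigma02.exists_primrecPred {S : ℕ → ℕ → Prop} (h : IsSigma02 S) :
    ∃ Q : ℕ → ℕ → ℕ → ℕ → Prop, (PrimrecPred fun p : ℕ × ℕ × ℕ × ℕ => Q p.1 p.2.1 p.2.2.1 p.2.2.2) ∧
      ∀ x y, S x y ↔ ∃ a, ∀ b, Q x y a b := by
  obtain ⟨R, hR, hS⟩ := h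
  obtain ⟨c, hc⟩ := Nat.Partrec.Code.exists_code.1 hR
  have hmem (p : ℕ × ℕ × ℕ × ℕ) :
      Encodable.encode false ∈ c.eval (Encodable.encode p) ↔ R p = false := by
    rw [hc]
    simp only [Encodable.encodek, Part.coe_some, Part.bind_some, PFun.coe_val, Part.map_some,
      Part.mem_some_iff, Encodable.encode_inj]
    exact eq_comm
  refine ⟨fun x y a b => Nat.Partrec.Code.evaln b.unpair.2 c
    (Encodable.encode (x, y, a, b.unpair.1)) ≠ some (Encodable.encode false), ?_, fun x y => ?_⟩
  · have hb : Primrec fun p : ℕ × ℕ × ℕ × ℕ => p.2.2.2.unpair :=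
      Primrec.unpair.comp (Primrec.snd.comp (Primrec.snd.comp Primrec.snd))
    refine (Primrec.eq.comp (Nat.Partrec.Code.primrec_evaln.comp
      (((Primrec.snd.comp hb).pair (Primrec.const c)).pair (Primrec.encode.comp
        (Primrec.fst.pair ((Primrec.fst.comp Primrec.snd).pair
          ((Primrec.fst.comp (Primrec.snd.comp Primrec.snd)).pair (Primrec.fst.comp hb)))))))
      (Primrec.const (some (Encodable.encode false)))).not
  · rw [hS]
    refine exists_congr fun a => ?_
    constructor
    · intro h b hb
      have := (hmem (x, y, a, b.unpair.1)).1 (Nat.Partrec.Code.evaln_sound hb)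
      rw [h] at this
      cases this
    · intro h b
      by_contra hb
      obtain ⟨s, hs⟩ := Nat.Partrec.Code.evaln_complete.1
        ((hmem (x, y, a, b)).2 (Bool.eq_false_iff.2 hb))
      exact h (Nat.pair b s) (by simpa using hs)

theorem PrimrecRel.exists_lt_comp {α : Type*} [Primcodable α] {R : ℕ → α → Prop} {f : α → ℕ}
    (hR : PrimrecRel R) (hf : Primrec f) : PrimrecPred fun a => ∃ x < f a, R x a :=
  (hR.exists_mem_list.comp (Primrec.list_range.comp hf) Primrec.id).of_eq (by simp)

theorem PrimrecRel.forall_lt_comp {α : Type*} [Primcodable α] {R : ℕ → α → Prop} {f : α → ℕ}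
    (hR : PrimrecRel R) (hf : Primrec f) : PrimrecPred fun a => ∀ x < f a, R x a :=
  (hR.forall_mem_list.comp (Primrec.list_range.comp hf) Primrec.id).of_eq (by simp)

/-! ### Finite upwards closed sets for a stagewise approximation of the preorder -/

namespace PreorderApprox

variable (Q : ℕ → ℕ → ℕ → ℕ → Prop)

/-- The first `n` instances do not refute `a` as a witness for the pair `(u, v)`. -/
def Survives (u v a n : ℕ) : Prop := ∀ b < n, Q u v a b

/-- At stage `n`, a triple of numbers below `l` has just been refuted, or `n = 0`. -/
def IsStage (l n : ℕ) : Prop :=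
  n = 0 ∨ ∃ u < l, ∃ v < l, ∃ a < l, Survives Q u v a (n - 1) ∧ ¬ Q u v a (n - 1)

/-- The set described by `D` is upwards closed for the approximation at stage `n`. -/
def IsClosed (D : List Bool) (n : ℕ) : Prop :=
  ∀ u < D.length, ∀ v < D.length, (∃ a < D.length, Survives Q u v a n) →
    D[u]? = some true → D[v]? = some true

open Classical in
/-- If `j` is the code of a list that describes an upwards closed set, together with a stage, then
this is the list. -/
noncomputable def column (j : ℕ) : List Bool :=
  let p := (Encodable.decode (α := List Bool × ℕ) j).getD ([], 0)
  if Encodable.encode p = j ∧ IsStage Q p.1.length p.2 ∧ IsClosed Q p.1 p.2 then p.1 else []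

variable {Q}

/-- The test on the code in `column` ties each pair to a single `j`, so that finitely many pairs
account for finitely many `j`. -/
theorem column_getElem? {j x : ℕ} : (column Q j)[x]? = some true ↔
    ∃ D n, Encodable.encode (D, n) = j ∧ IsStage Q D.length n ∧ IsClosed Q D n ∧
      D[x]? = some true := by
  unfold column
  constructor
  · dsimp only
    split_ifs with h
    · exact fun hx => ⟨_, _, h.1, h.2.1, h.2.2, hx⟩
    · simp
  · rintro ⟨D, n, rfl, h₁, h₂, hx⟩
    simpa [h₁, h₂] using hx

section Primrec

variable (hQ : PrimrecPred fun p : ℕ × ℕ × ℕ × ℕ => Q p.1 p.2.1 p.2.2.1 p.2.2.2)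
include hQ

theorem survives_primrec :
    PrimrecPred fun p : ℕ × ℕ × ℕ × ℕ => Survives Q p.1 p.2.1 p.2.2.1 p.2.2.2 := by
  have : PrimrecRel fun (b : ℕ) (p : ℕ × ℕ × ℕ × ℕ) => Q p.1 p.2.1 p.2.2.1 b :=
    PrimrecPred.comp (f := fun q : ℕ × ℕ × ℕ × ℕ × ℕ => (q.2.1, q.2.2.1, q.2.2.2.1, q.1)) hQ
      ((Primrec.fst.comp Primrec.snd).pair
        ((Primrec.fst.comp (Primrec.snd.comp Primrec.snd)).pair
          ((Primrec.fst.comp (Primrec.snd.comp (Primrec.snd.comp Primrec.snd))).pair Primrec.fst)))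
  exact this.forall_lt_comp (Primrec.snd.comp (Primrec.snd.comp Primrec.snd))

theorem isStage_primrec : PrimrecRel (IsStage Q) := by
  have h₁ : PrimrecRel fun (a : ℕ) (p : ℕ × ℕ × ℕ × ℕ) =>
      Survives Q p.2.1 p.1 a (p.2.2.2 - 1) ∧ ¬ Q p.2.1 p.1 a (p.2.2.2 - 1) := by
    have hf : Primrec fun q : ℕ × ℕ × ℕ × ℕ × ℕ => (q.2.2.1, q.2.1, q.1, q.2.2.2.2 - 1) :=
      (Primrec.fst.comp (Primrec.snd.comp Primrec.snd)).pair
        ((Primrec.fst.comp Primrec.snd).pair (Primrec.fst.pair (Primrec.pred.comp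
          (Primrec.snd.comp (Primrec.snd.comp (Primrec.snd.comp Primrec.snd))))))
    exact ((survives_primrec hQ).comp hf).and (hQ.comp hf).not
  have h₂ : PrimrecRel fun (v : ℕ) (p : ℕ × ℕ × ℕ) => ∃ a < p.2.1,
      Survives Q p.1 v a (p.2.2 - 1) ∧ ¬ Q p.1 v a (p.2.2 - 1) :=
    h₁.exists_lt_comp (Primrec.fst.comp (Primrec.snd.comp Primrec.snd))
  have h₃ : PrimrecRel fun (u : ℕ) (p : ℕ × ℕ) => ∃ v < p.1, ∃ a < p.1,
      Survives Q u v a (p.2 - 1) ∧ ¬ Q u v a (p.2 - 1) :=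
    h₂.exists_lt_comp (Primrec.fst.comp Primrec.snd)
  exact (Primrec.eq.comp Primrec.snd (Primrec.const 0)).or
    (h₃.exists_lt_comp Primrec.fst)

theorem isClosed_primrec : PrimrecRel (IsClosed Q) := by
  have h₁ : PrimrecRel fun (a : ℕ) (p : ℕ × ℕ × List Bool × ℕ) => Survives Q p.2.1 p.1 a p.2.2.2 :=
    PrimrecPred.comp (f := fun q : ℕ × ℕ × ℕ × List Bool × ℕ => (q.2.2.1, q.2.1, q.1, q.2.2.2.2))
      (survives_primrec hQ)
      ((Primrec.fst.comp (Primrec.snd.comp Primrec.snd)).pair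
        ((Primrec.fst.comp Primrec.snd).pair (Primrec.fst.pair
          (Primrec.snd.comp (Primrec.snd.comp (Primrec.snd.comp Primrec.snd))))))
  have hD : Primrec fun p : ℕ × ℕ × List Bool × ℕ => p.2.2.1 :=
    Primrec.fst.comp (Primrec.snd.comp Primrec.snd)
  have h₂ : PrimrecRel fun (v : ℕ) (p : ℕ × List Bool × ℕ) =>
      (∃ a < p.2.1.length, Survives Q p.1 v a p.2.2) →
        p.2.1[p.1]? = some true → p.2.1[v]? = some true := by
    refine PrimrecPred.of_eq ((h₁.exists_lt_comp (Primrec.list_length.comp hD)).not.or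
      ((Primrec.eq.comp (Primrec.list_getElem?.comp hD (Primrec.fst.comp Primrec.snd))
        (Primrec.const (some true))).not.or
        (Primrec.eq.comp (Primrec.list_getElem?.comp hD Primrec.fst)
          (Primrec.const (some true))))) fun p => ?_
    simp only [imp_iff_not_or]
  have h₃ : PrimrecRel fun (u : ℕ) (p : List Bool × ℕ) => ∀ v < p.1.length,
      (∃ a < p.1.length, Survives Q u v a p.2) →
        p.1[u]? = some true → p.1[v]? = some true :=
    h₂.forall_lt_comp (Primrec.list_length.comp (Primrec.fst.comp Primrec.snd))
  exact h₃.forall_lt_comp (Primrec.list_length.comp Primrec.fst)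

theorem column_primrec : Primrec (column Q) := by
  classical
  have hp : Primrec fun j => (Encodable.decode (α := List Bool × ℕ) j).getD ([], 0) :=
    Primrec.option_getD.comp Primrec.decode (Primrec.const ([], 0))
  exact (Primrec.ite ((Primrec.eq.comp (Primrec.encode.comp hp) Primrec.id).and
    (((isStage_primrec hQ).comp (Primrec.list_length.comp (Primrec.fst.comp hp))
      (Primrec.snd.comp hp)).and ((isClosed_primrec hQ).comp (Primrec.fst.comp hp)
        (Primrec.snd.comp hp)))) (Primrec.fst.comp hp) (Primrec.const [])).of_eq fun j => rfl

end Primrec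

/-- A triple has at most one first refuting instance, and there are finitely many triples below `l`.
-/
theorem finite_setOf_isStage (l : ℕ) : {n | IsStage Q l n}.Finite := by
  have hfin (u v a : ℕ) : {n | Survives Q u v a (n - 1) ∧ ¬ Q u v a (n - 1)}.Finite := by
    by_cases h : ∃ b, ¬ Q u v a b
    · obtain ⟨b, hb⟩ := h
      refine (Set.finite_Iic (b + 1)).subset fun n hn => ?_
      by_contra hlt
      exact hb (hn.1 b (by simp at hlt; omega))
    · push Not at h
      exact Set.finite_empty.subset fun n hn => hn.2 (h _)
  refine ((Set.finite_singleton 0).union ((Set.finite_Iio l).biUnion fun u _ =>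
    (Set.finite_Iio l).biUnion fun v _ => (Set.finite_Iio l).biUnion fun a _ =>
      hfin u v a)).subset ?_
  rintro n (h | ⟨u, hu, v, hv, a, ha, h⟩)
  · exact Or.inl h
  · refine Or.inr ?_
    simp only [Set.mem_iUnion]
    exact ⟨u, hu, v, hv, a, ha, h⟩

/-- At some stage, all triples below `l` that are ever refuted have been refuted. -/
theorem exists_isStage (l : ℕ) : ∃ n, IsStage Q l n ∧
    ∀ u < l, ∀ v < l, ∀ a < l, Survives Q u v a n → ∀ b, Q u v a b := by
  classical
  have hex : ∃ n, ∀ u < l, ∀ v < l, ∀ a < l, Survives Q u v a n → ∀ b, Q u v a b := by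
    have (p : ℕ × ℕ × ℕ) : ∃ n, Survives Q p.1 p.2.1 p.2.2 n → ∀ b, Q p.1 p.2.1 p.2.2 b := by
      by_cases h : ∀ b, Q p.1 p.2.1 p.2.2 b
      · exact ⟨0, fun _ => h⟩
      · push Not at h
        obtain ⟨b, hb⟩ := h
        exact ⟨b + 1, fun h => absurd (h b b.lt_succ_self) hb⟩
    choose f hf using this
    refine ⟨(Finset.range l ×ˢ Finset.range l ×ˢ Finset.range l).sup f,
      fun u hu v hv a ha h => hf (u, v, a) fun b hb => h b (hb.trans_le ?_)⟩
    exact Finset.le_sup (f := f) (by simp [hu, hv, ha])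
  -- The least such number is a stage: if it is positive, its predecessor fails for a false triple
  -- that has survived so far, and this triple must be refuted by the very next instance.
  refine ⟨Nat.find hex, ?_, Nat.find_spec hex⟩
  rcases Nat.eq_zero_or_pos (Nat.find hex) with h0 | h0
  · exact Or.inl h0
  · have := Nat.find_min hex (Nat.sub_one_lt h0.ne')
    push Not at this
    obtain ⟨u, hu, v, hv, a, ha, hs, b, hb⟩ := this
    refine Or.inr ⟨u, hu, v, hv, a, ha, hs, fun h => hb ?_⟩
    refine Nat.find_spec hex u hu v hv a ha (fun b' hb' => ?_) b
    rcases Nat.lt_or_ge b' (Nat.find hex - 1) with h' | h'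
    · exact hs b' h'
    · rwa [show b' = Nat.find hex - 1 by omega]

theorem finite_iff {S : ℕ → ℕ → Prop} [IsPreorder ℕ S]
    (hS : ∀ x y, S x y ↔ ∃ a, ∀ b, Q x y a b) (x y : ℕ) :
    {j | (column Q j)[x]? = some true ∧ (column Q j)[y]? ≠ some true}.Finite ↔ S x y := by
  classical
  constructor
  · intro hfin
    by_contra hxy
    -- If the set were finite, its columns would have bounded length; a truncated cone above `x`
    -- longer than the bound contradicts this.
    obtain ⟨B, hB⟩ := (hfin.image fun j => (column Q j).length).bddAbove
    obtain ⟨l, hx, hy, hl⟩ : ∃ l, x < l ∧ y < l ∧ B < l := ⟨x + y + B + 1, by omega⟩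
    obtain ⟨n, hn, hQ⟩ := exists_isStage (Q := Q) l
    let D : List Bool := (List.range l).map fun v => decide (S x v)
    have hD (v : ℕ) (hv : v < l) : D[v]? = some true ↔ S x v := by
      simp [D, List.getElem?_map, List.getElem?_range hv]
    have hlen : D.length = l := by simp [D]
    have hcl : IsClosed Q D n := by
      intro u hu v hv ⟨a, ha, hs⟩ hxu
      rw [hlen] at hu hv ha
      rw [hD _ hv]
      exact _root_.trans ((hD _ hu).1 hxu) ((hS u v).2 ⟨a, hQ u hu v hv a ha hs⟩)
    rw [← hlen] at hn
    have hcol : column Q (Encodable.encode (D, n)) = D := by simp [column, hn, hcl]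
    have := hB ⟨Encodable.encode (D, n), ⟨by rw [hcol, hD x hx]; exact refl x,
      by rwa [hcol, Ne, hD y hy]⟩, rfl⟩
    simp only [hcol, hlen] at this
    omega
  · rw [hS]
    rintro ⟨a, ha⟩
    -- Once the length exceeds both `y` and the witness `a`, closure forces `y` into every column
    -- that contains `x`, as `a` is never refuted. Only shorter columns can be exceptions.
    have hfin : ((⋃ l ∈ Set.Iic (max y a), {D : List Bool | D.length = l} ×ˢ
        {n | IsStage Q l n})).Finite :=
      (Set.finite_Iic _).biUnion fun l _ =>
        (List.finite_length_eq Bool l).prod (finite_setOf_isStage l)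
    refine (hfin.image Encodable.encode).subset fun j hj => ?_
    obtain ⟨D, n, rfl, hst, hcl, hx⟩ := column_getElem?.1 hj.1
    have hxD : x < D.length := (List.getElem?_eq_some_iff.1 hx).1
    refine Set.mem_image_of_mem _ ?_
    simp only [Set.mem_iUnion]
    refine ⟨D.length, ?_, rfl, hst⟩
    by_contra hlt
    simp only [Set.mem_Iic, le_max_iff, not_or, not_le] at hlt
    exact hj.2 (column_getElem?.2 ⟨D, n, rfl, hst, hcl,
      hcl x hxD y hlt.1 ⟨a, hlt.2, fun b _ => ha b⟩ hx⟩)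

end PreorderApprox

theorem almostSubset_image {α β : Type*} {f : α → β} (hf : Function.Injective f) (A B : Set α) :
    AlmostSubset (f '' A) (f '' B) ↔ AlmostSubset A B := by
  rw [AlmostSubset, AlmostSubset, ← Set.image_sdiff hf, Set.finite_image_iff hf.injOn]

theorem compReducible_almostSubset {S : ℕ → ℕ → Prop} [IsPreorder ℕ S] (h : IsSigma02 S) :
    CompReducible S fun e i => AlmostSubset (quadLang e) (quadLang i) := by
  obtain ⟨Q, hQ, hS⟩ := h.exists_primrecPred
  obtain ⟨g, word, hg, hword, hgx⟩ :=
    exists_quadLang_eq_image (PreorderApprox.column_primrec hQ)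
  refine ⟨g, hg, fun x y => ?_⟩
  beta_reduce
  rw [hgx, hgx, almostSubset_image hword]
  exact (PreorderApprox.finite_iff hS x y).symm

theorem theorem3p8 :
    Set.range quadLang = DTIME (fun n => n ^ 2) ∧
      IsSigma02CompletePreorder (fun e i => AlmostSubset (quadLang e) (quadLang i)) :=
  ⟨range_quadLang, isPreorder_almostSubset, isSigma02_almostSubset,
    fun _ _ h => compReducible_almostSubset h⟩
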